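/- **Theorem (unconditional real-RAM lower bound for dynamic trace estimation).** For $p\in[1,2]$ let $\|A\|_p=(\sum_i\sigma_i(A)^p)^{1/p}$ denote the Schatten-$p$ norm of a real square matrix $A$ with singular values $\sigma_i(A)$. Let $0<\alpha\le 1$ and let $m,n$ be natural numbers. In dynamic trace estimation under a Schatten-$p$ norm assumption, a stream $A_1,\dots,A_m$ of real $n\times n$ matrices with $\|A_i\|_p\le 1$ for all $i$ and $\|A_{i+1}-A_i\|_p\le\alpha$ for all $i<m$ arrives one matrix at a time. An algorithm is randomized and computes with exact real numbers (between queries it may apply arbitrary Borel measurable functions to its random seed and the answers received so far). At time step $i$ it may ask, one after another and adaptively, for products $A_jx$ with $j\le i$ and $x\in\mathbb R^n$ of its choice, as many as it decides, and then outputs an estimate $t_i$ before $A_{i+1}$ arrives. It solves the problem with error $\varepsilon$ and failure rate $\delta$ if, for every such stream and for each single $i\in\{1,\dots,m\}$, $|t_i-\operatorname{tr}A_i|\le\varepsilon$ with probability at least $1-\delta$. For every $\delta_0<1/2$ there is a constant $c>0$, depending only on $\delta_0$, such that the following holds for all $p\in[1,2]$, all $0<\delta\le\delta_0$, all $0<\varepsilon<1$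 with $\varepsilon<(\log(1/\delta))^{1/2-1/p}$, all $0<\alpha\le1$, all $m$, and all dimensions $n\ge(\sqrt{\log(1/\delta)}/\varepsilon)^p$. If an algorithm solves dynamic trace estimation with these parameters and, on every such stream, almost surely makes at most $Q$ matrix-vector queries in total over all time steps, then $$Q\;\ge\; c\,\alpha m\left(\frac{\sqrt{\log(1/\delta)}}{\varepsilon}\right)^{p}.$$ -/

import Mathlib

open MeasureTheory

/-- The Schatten-`p` norm `(∑ᵢ σᵢ ^ p) ^ (1 / p)` of a real square matrix, where
`σ₀ ≥ σ₁ ≥ … ≥ σₙ₋₁` are its singular values (with multiplicity). -/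
noncomputable def schattenNorm {n : ℕ} (p : ℝ) (A : Matrix (Fin n) (Fin n) ℝ) : ℝ :=
  (∑ i ∈ Finset.range n, (Matrix.toEuclideanLin A).singularValues i ^ p) ^ (1 / p)

/-- The inputs of dynamic trace estimation under a Schatten-`p` norm assumption: a stream
`A 0, …, A (m - 1)` of real square matrices (later entries of the sequence `A` are irrelevant) of
Schatten-`p` norm at most `1`, whose consecutive differences have Schatten-`p` norm at most `α`. -/
structure IsDynamicInput {n : ℕ} (m : ℕ) (p α : ℝ) (A : ℕ → Matrix (Fin n) (Fin n) ℝ) : Prop where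
  norm_le : ∀ i, i < m → schattenNorm p (A i) ≤ 1
  norm_sub_le : ∀ i, i + 1 < m → schattenNorm p (A (i + 1) - A i) ≤ α

/-- A randomized adaptive matrix-vector query algorithm on streams of real `n × n` matrices, with
random seed in `Ω`. Arithmetic is exact and query vectors are arbitrary real vectors.

At time step `i`, having received `k` answers altogether, the algorithm looks at the pair `x` of
its seed and the sequence of these answers (the entries `0, …, k - 1`; all entries from `k` on are
zero). Either `x ∈ asks i k`, and it queries the product of the matrix with number `index i k x`
(one of those that have arrived) and the vector `vector i k x`; or `x ∉ asks i k`, and it outputs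
the estimate `report i k x` for the current trace and goes on to the next time step. The earlier
queries, outputs and decisions are functions of the seed and the earlier answers, so that they need
not be recorded separately.

The only restriction on the computation between two queries is that it be Borel measurable. -/
structure DynamicAlgorithm (Ω : Type*) [MeasurableSpace Ω] (n : ℕ) where
  asks : ℕ → ℕ → Set (Ω × (ℕ → Fin n → ℝ))
  index : ℕ → ℕ → Ω × (ℕ → Fin n → ℝ) → ℕ
  vector : ℕ → ℕ → Ω × (ℕ → Fin n → ℝ) → Fin n → ℝ
  report : ℕ → ℕ → Ω × (ℕ → Fin n → ℝ) → ℝ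
  index_le : ∀ i k x, index i k x ≤ i
  measurableSet_asks : ∀ i k, MeasurableSet (asks i k)
  measurable_index : ∀ i k, Measurable (index i k)
  measurable_vector : ∀ i k, Measurable (vector i k)
  measurable_report : ∀ i k, Measurable (report i k)

/-- A configuration of a running algorithm: the current time step, the number of queries made so
far, and the answers received so far (padded by zero vectors). -/
structure Configuration (n : ℕ) where
  time : ℕ
  count : ℕ
  answers : ℕ → Fin n → ℝ

namespace DynamicAlgorithm

variable {Ω : Type*} [MeasurableSpace Ω] {n : ℕ}

open Classical in
/-- One move on the stream `A 0, …, A (m - 1)` with seed `ω`: a query, or the passage to the next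
time step. Nothing happens any more once all `m` time steps are over. -/
noncomputable def step (alg : DynamicAlgorithm Ω n) (m : ℕ) (A : ℕ → Matrix (Fin n) (Fin n) ℝ)
    (ω : Ω) (s : Configuration n) : Configuration n :=
  if s.time < m then
    if (ω, s.answers) ∈ alg.asks s.time s.count then
      { time := s.time
        count := s.count + 1
        answers := Function.update s.answers s.count
          ((A (alg.index s.time s.count (ω, s.answers))).mulVec
            (alg.vector s.time s.count (ω, s.answers))) }
    else
      { time := s.time + 1
        count := s.count
        answers := s.answers }
  else s

/-- The configuration after `j` moves, starting at time step `0` without any answer. -/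
noncomputable def run (alg : DynamicAlgorithm Ω n) (m : ℕ) (A : ℕ → Matrix (Fin n) (Fin n) ℝ)
    (ω : Ω) (j : ℕ) : Configuration n :=
  (alg.step m A ω)^[j] { time := 0, count := 0, answers := 0 }

/-- In the run on `A 0, …, A (m - 1)` with seed `ω`, the algorithm outputs the estimate `t` at time
step `i`. (If it goes on querying forever at an earlier time step or at this one, there is no
such `t`.) -/
def Outputs (alg : DynamicAlgorithm Ω n) (m : ℕ) (A : ℕ → Matrix (Fin n) (Fin n) ℝ)
    (ω : Ω) (i : ℕ) (t : ℝ) : Prop :=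
  ∃ j, (alg.run m A ω j).time = i ∧ i < m ∧
    (ω, (alg.run m A ω j).answers) ∉ alg.asks i (alg.run m A ω j).count ∧
    alg.report i (alg.run m A ω j).count (ω, (alg.run m A ω j).answers) = t

/-- The algorithm solves dynamic trace estimation on streams of `m` matrices under a Schatten-`p`
norm assumption with difference bound `α`: on each admissible stream, for each single time step,
the estimate is within `ε` of the trace with probability at least `1 - δ` over the seed. -/
def Solves (alg : DynamicAlgorithm Ω n) (μ : Measure Ω) (m : ℕ) (p α ε δ : ℝ) : Prop :=
  ∀ A, IsDynamicInput m p α A → ∀ i, i < m →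
    1 - δ ≤ μ.real {ω | ∃ t, alg.Outputs m A ω i t ∧ |t - (A i).trace| ≤ ε}

/-- On each admissible stream, almost surely, the algorithm makes at most `Q` queries in total. -/
def UsesAtMost (alg : DynamicAlgorithm Ω n) (μ : Measure Ω) (m : ℕ) (p α : ℝ) (Q : ℕ) : Prop :=
  ∀ A, IsDynamicInput m p α A → ∀ᵐ ω ∂μ, ∀ j, (alg.run m A ω j).count ≤ Q

end DynamicAlgorithm

/-! Averaging over a random stream. The stream oscillates between zero and independent random
matrices along a triangle wave with steps `1 / s ≤ α`, where `s = ⌈1 / α⌉`; this fits at least `α m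
/ 4` peaks. Each random matrix is a rescaled `N × N` Gaussian in the upper left corner, with `N` a
constant multiple of `K = (√(log (1/δ)) / ε) ^ p`. It is replaced by zero on the rare event that its
norm is too large, so that every stream is admissible. Each peak demands the trace of a fresh
matrix.

Adaptivity and exact arithmetic are handled by resampling. Fix the seed and all other blocks. The
run depends on the Gaussian `G` only through `G * p`, where `p` projects onto the span of the
vectors asked so far (`IsExploration.congr`). Replacing `G * (1 - p)` by an independent copy
therefore leaves the run unchanged, and it also preserves the law of `G`, although `p` is itself
random (`lintegral_splice_exploredProj`). The trace of `p` is at most the number of queries made in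
the block's time window (`trace_exploredProj_add_count_le`). After at most `k = N / 2` of them,
rounded down, the unknown part of the trace is a centred normal variable of variance at least `N /
2`, up to scaling. Hence any estimate misses with probability at least some `ρ` (`gaussian_block`),
where `N` and `ρ` are chosen such that `ρ` exceeds `δ` by a constant factor.

Since the algorithm errs with probability at most `δ`, each window contains more than `k` queries
with probability bounded below. The windows are disjoint, so the expected counts add up to at most
`Q` (`card_blocks_mul_le`).

The bound on `ε` means `log (1/δ) < K` (`log_lt_rpow`); this makes the truncation error `2 * exp
(-N² / 2)` negligible against `δ` once `K` is large. For bounded `K`, random signs in dimension one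
suffice: without a query they cannot be guessed (`isHardBlock_signMat`). -/

/-! ### Schatten norms of matrices supported in a corner. -/

open Matrix in
theorem sum_sq_singularValues {n : ℕ} (A : Matrix (Fin n) (Fin n) ℝ) :
    ∑ i ∈ Finset.range n, (Matrix.toEuclideanLin A).singularValues i ^ 2 = (Aᵀ * A).trace := by
  set T := Matrix.toEuclideanLin A with hT
  have hn : Module.finrank ℝ (EuclideanSpace ℝ (Fin n)) = n := by simp
  rw [Finset.sum_range]
  have h1 := T.isPositive_adjoint_comp_self.isSymmetric.trace_eq_sum_eigenvalues hn
  have h2 : ∀ i : Fin n, T.singularValues i ^ 2 = _ := fun i => T.sq_singularValues_fin hn i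
  simp_rw [h2]
  simp only [RCLike.ofReal_real_eq_id, id] at h1
  rw [← h1, hT, ← Matrix.toEuclideanLin_conjTranspose_eq_adjoint,
    conjTranspose_eq_transpose_of_trivial]
  simp only [Matrix.toEuclideanLin_eq_toLin_orthonormal]
  rw [← Matrix.toLin_mul, Matrix.trace_toLin_eq]

/-- The isometric inclusion of the first `N` coordinates. -/
def inclusionMatrix {N n : ℕ} (h : N ≤ n) : Matrix (Fin n) (Fin N) ℝ :=
  Matrix.of fun i j => if i = Fin.castLE h j then 1 else 0

open Matrix in
theorem inclusionMatrix_transpose_mul_self {N n : ℕ} (h : N ≤ n) :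
    (inclusionMatrix h)ᵀ * inclusionMatrix h = 1 := by
  ext i j
  simp [Matrix.mul_apply, inclusionMatrix, Matrix.one_apply, eq_comm]

open Matrix in
/-- The upper left corner embedding of matrices. -/
def corner {N n : ℕ} (h : N ≤ n) (G : Matrix (Fin N) (Fin N) ℝ) : Matrix (Fin n) (Fin n) ℝ :=
  inclusionMatrix h * G * (inclusionMatrix h)ᵀ

open Matrix in
theorem trace_corner {N n : ℕ} (h : N ≤ n) (G : Matrix (Fin N) (Fin N) ℝ) :
    (corner h G).trace = G.trace := by
  rw [corner, Matrix.mul_assoc, Matrix.trace_mul_comm, Matrix.mul_assoc,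
    inclusionMatrix_transpose_mul_self, Matrix.mul_one]

open Matrix in
theorem corner_transpose_mul_corner {N n : ℕ} (h : N ≤ n) (G : Matrix (Fin N) (Fin N) ℝ) :
    (corner h G)ᵀ * corner h G = corner h (Gᵀ * G) := by
  simp only [corner, transpose_mul, transpose_transpose]
  calc _ = inclusionMatrix h * Gᵀ * ((inclusionMatrix h)ᵀ * inclusionMatrix h) * G *
      (inclusionMatrix h)ᵀ := by simp only [Matrix.mul_assoc]
    _ = _ := by
      rw [inclusionMatrix_transpose_mul_self]
      simp only [Matrix.mul_assoc, Matrix.mul_one]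

theorem corner_smul {N n : ℕ} (h : N ≤ n) (a : ℝ) (G : Matrix (Fin N) (Fin N) ℝ) :
    corner h (a • G) = a • corner h G := by
  simp [corner]

theorem rank_corner_le {N n : ℕ} (h : N ≤ n) (G : Matrix (Fin N) (Fin N) ℝ) :
    (corner h G).rank ≤ N := by
  refine (Matrix.rank_mul_le_right _ _).trans ?_
  simpa using (Matrix.rank_le_card_height (inclusionMatrix h).transpose)

theorem finrank_range_toEuclideanLin {n : ℕ} (A : Matrix (Fin n) (Fin n) ℝ) :
    Module.finrank ℝ (Matrix.toEuclideanLin A).range = A.rank := by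
  rw [Matrix.rank_eq_finrank_range_toLin A (EuclideanSpace.basisFun (Fin n) ℝ).toBasis
    (EuclideanSpace.basisFun (Fin n) ℝ).toBasis, Matrix.toEuclideanLin_eq_toLin_orthonormal]

/-- The rank is at most `N`, so only `N` singular values matter, and Hölder's inequality compares
their `p`-norm with their 2-norm, which is the Frobenius norm. -/
theorem schattenNorm_corner_le {N n : ℕ} (h : N ≤ n) {p : ℝ} (hp1 : 1 ≤ p) (hp2 : p ≤ 2)
    (hN : 0 < N) (G : Matrix (Fin N) (Fin N) ℝ) :
    schattenNorm p (corner h G) ≤ (N : ℝ) ^ (1 / p - 1 / 2) * √(∑ i, ∑ j, G i j ^ 2) := by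
  set σ := (Matrix.toEuclideanLin (corner h G)).singularValues with hσ
  have hp0 : 0 < p := by linarith
  have hz : ∀ i, N ≤ i → σ i = 0 := fun i hi => by
    rw [hσ, LinearMap.singularValues_eq_zero_iff_le_finrank_range, finrank_range_toEuclideanLin]
    exact (rank_corner_le h G).trans hi
  have hnn : ∀ i, 0 ≤ σ i := fun i => LinearMap.singularValues_nonneg _ i
  have hsub : Finset.range N ⊆ Finset.range n := Finset.range_subset_range.2 h
  have e1 : ∑ i ∈ Finset.range n, σ i ^ p = ∑ i ∈ Finset.range N, σ i ^ p := by
    symm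
    refine Finset.sum_subset hsub fun i _ hi => ?_
    rw [hz i (by simpa using hi), Real.zero_rpow hp0.ne']
  have e2 : ∑ i ∈ Finset.range N, σ i ^ 2 = ∑ i, ∑ j, G i j ^ 2 := by
    have : ∑ i ∈ Finset.range N, σ i ^ 2 = ∑ i ∈ Finset.range n, σ i ^ 2 := by
      refine Finset.sum_subset hsub fun i _ hi => ?_
      rw [hz i (by simpa using hi)]; norm_num
    rw [this, sum_sq_singularValues, corner_transpose_mul_corner, trace_corner, Matrix.trace]
    rw [Finset.sum_comm]
    simp [Matrix.mul_apply, sq]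
  have hq : 1 ≤ 2 / p := by rw [le_div_iff₀ hp0]; linarith
  have hS : 0 ≤ ∑ i ∈ Finset.range N, σ i ^ p :=
    Finset.sum_nonneg fun i _ => Real.rpow_nonneg (hnn i) _
  -- Convexity of `x ^ (2 / p)`, applied to the numbers `σ i ^ p`.
  have key := Real.rpow_sum_le_const_mul_sum_rpow (Finset.range N) (fun i => σ i ^ p) hq
  have e3 : ∀ i, |σ i ^ p| = σ i ^ p := fun i => abs_of_nonneg (Real.rpow_nonneg (hnn i) _)
  have e4 : ∀ i, (σ i ^ p) ^ (2 / p) = σ i ^ 2 := fun i => by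
    rw [← Real.rpow_mul (hnn i), mul_div_cancel₀ _ hp0.ne', Real.rpow_two]
  simp only [e3, e4, e2, Finset.card_range] at key
  rw [schattenNorm, ← hσ, e1]
  have e5 : (∑ i ∈ Finset.range N, σ i ^ p) ^ (1 / p)
      = ((∑ i ∈ Finset.range N, σ i ^ p) ^ (2 / p)) ^ (1 / 2 : ℝ) := by
    rw [← Real.rpow_mul hS]; congr 1; ring
  rw [e5, Real.sqrt_eq_rpow]
  have hN' : (0 : ℝ) ≤ N := by positivity
  have e6 : (N : ℝ) ^ (1 / p - 1 / 2) = ((N : ℝ) ^ (2 / p - 1)) ^ (1 / 2 : ℝ) := by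
    rw [← Real.rpow_mul hN']; congr 1; ring
  rw [e6, ← Real.mul_rpow (by positivity) (by positivity)]
  exact Real.rpow_le_rpow (by positivity) key (by norm_num)

namespace DynamicAlgorithm

/-! ### Runs and their truncation to fewer time steps. -/

section Run

variable {Ω : Type*} [MeasurableSpace Ω] {n : ℕ} (alg : DynamicAlgorithm Ω n)
  (m : ℕ) (A : ℕ → Matrix (Fin n) (Fin n) ℝ) (ω : Ω)

theorem run_zero : alg.run m A ω 0 = ⟨0, 0, 0⟩ := rfl

theorem run_succ (j : ℕ) : alg.run m A ω (j + 1) = alg.step m A ω (alg.run m A ω j) :=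
  Function.iterate_succ_apply' _ _ _

theorem step_of_le {s : Configuration n} (h : m ≤ s.time) : alg.step m A ω s = s := by
  simp [step, not_lt.2 h]

theorem step_of_asks {s : Configuration n} (h : s.time < m)
    (hs : (ω, s.answers) ∈ alg.asks s.time s.count) :
    alg.step m A ω s = ⟨s.time, s.count + 1, Function.update s.answers s.count
      ((A (alg.index s.time s.count (ω, s.answers))).mulVec
        (alg.vector s.time s.count (ω, s.answers)))⟩ := by
  simp [step, h, hs]

theorem step_of_not_asks {s : Configuration n} (h : s.time < m)
    (hs : (ω, s.answers) ∉ alg.asks s.time s.count) :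
    alg.step m A ω s = ⟨s.time + 1, s.count, s.answers⟩ := by
  simp [step, h, hs]

theorem step_eq_of_lt {m m' : ℕ} {s : Configuration n} (h : s.time < m) (h' : s.time < m') :
    alg.step m A ω s = alg.step m' A ω s := by
  simp [step, h, h']

theorem step_cases (s : Configuration n) :
    (m ≤ s.time ∧ alg.step m A ω s = s) ∨
      (s.time < m ∧ (alg.step m A ω s).time = s.time ∧
        (alg.step m A ω s).count = s.count + 1) ∨
      (s.time < m ∧ (alg.step m A ω s).time = s.time + 1 ∧
        (alg.step m A ω s).count = s.count) := by
  rcases le_or_gt m s.time with h | h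
  · exact .inl ⟨h, alg.step_of_le m A ω h⟩
  · by_cases hs : (ω, s.answers) ∈ alg.asks s.time s.count
    · exact .inr (.inl ⟨h, by simp [alg.step_of_asks m A ω h hs]⟩)
    · exact .inr (.inr ⟨h, by simp [alg.step_of_not_asks m A ω h hs]⟩)

theorem time_le_time_succ (j : ℕ) : (alg.run m A ω j).time ≤ (alg.run m A ω (j + 1)).time := by
  rw [run_succ]
  rcases alg.step_cases m A ω (alg.run m A ω j) with h | h | h
  · rw [h.2]
  · omega
  · omega

theorem count_le_count_succ (j : ℕ) : (alg.run m A ω j).count ≤ (alg.run m A ω (j + 1)).count := by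
  rw [run_succ]
  rcases alg.step_cases m A ω (alg.run m A ω j) with h | h | h
  · rw [h.2]
  · omega
  · omega

theorem count_mono : Monotone fun j => (alg.run m A ω j).count :=
  monotone_nat_of_le_succ (alg.count_le_count_succ m A ω)

/-- Until the stream is over, each move increases exactly one of the two counters. This bounds the
number of moves once queries are bounded. -/
theorem time_add_count (j : ℕ) (h : (alg.run m A ω j).time < m) :
    (alg.run m A ω j).time + (alg.run m A ω j).count = j := by
  induction j with
  | zero => simp [run_zero]
  | succ j ih =>
    have := ih ((alg.time_le_time_succ m A ω j).trans_lt h)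
    rw [run_succ] at h ⊢
    rcases alg.step_cases m A ω (alg.run m A ω j) with h' | h' | h'
    · rw [h'.2] at h
      omega
    · omega
    · omega

theorem run_eq_of_time_lt {M : ℕ} (hM : M ≤ m) (j : ℕ) (h : (alg.run m A ω j).time < M) :
    alg.run M A ω j = alg.run m A ω j := by
  induction j with
  | zero => rfl
  | succ j ih =>
    have h' := (alg.time_le_time_succ m A ω j).trans_lt h
    rw [run_succ, run_succ, ih h']
    exact alg.step_eq_of_lt A ω h' (h'.trans_le hM)

/-- Lowering the horizon only freezes the run at its entry into time step `M`. Query counts before a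
given time can thus be read off from truncated runs. -/
theorem exists_run_eq {M : ℕ} (hM : M ≤ m) (j : ℕ) :
    ∃ i ≤ j, alg.run M A ω j = alg.run m A ω i := by
  suffices alg.run M A ω j = alg.run m A ω j ∨
      M ≤ (alg.run M A ω j).time ∧ ∃ i ≤ j, alg.run M A ω j = alg.run m A ω i by
    rcases this with h | h
    · exact ⟨j, le_rfl, h⟩
    · exact h.2
  induction j with
  | zero => exact .inl rfl
  | succ j ih =>
    rcases le_or_gt M (alg.run M A ω j).time with h | h
    · have e : alg.run M A ω (j + 1) = alg.run M A ω j := by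
        rw [run_succ, alg.step_of_le M A ω h]
      rw [e]
      refine .inr ⟨h, ?_⟩
      rcases ih with h | ⟨-, i, hi, h⟩
      · exact ⟨j, by omega, h⟩
      · exact ⟨i, by omega, h⟩
    · rcases ih with h' | h'
      · left
        rw [run_succ, run_succ, ← h']
        exact alg.step_eq_of_lt A ω h (h.trans_le hM)
      · omega

theorem count_run_le_of_le {M : ℕ} (hM : M ≤ m) (j : ℕ) :
    (alg.run M A ω j).count ≤ (alg.run m A ω j).count := by
  obtain ⟨i, hi, h⟩ := alg.exists_run_eq m A ω hM j
  rw [h]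
  exact alg.count_mono m A ω hi

-- Replaces the unknown moment of the output by a fixed one: with horizon `i + 1` the run freezes
-- right at the report, and `m + Q` moves are enough to get there. This makes success a measurable
-- event.
variable {m A ω} in
theorem Outputs.run_eq {i Q : ℕ} {t : ℝ} (h : alg.Outputs m A ω i t)
    (hQ : ∀ j, (alg.run m A ω j).count ≤ Q) :
    (alg.run (i + 1) A ω (m + Q)).time = i + 1 ∧
      alg.report i (alg.run (i + 1) A ω (m + Q)).count
        (ω, (alg.run (i + 1) A ω (m + Q)).answers) = t := by
  obtain ⟨j, hj, him, has, hr⟩ := h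
  have e1 : alg.run (i + 1) A ω j = alg.run m A ω j :=
    alg.run_eq_of_time_lt m A ω him j (by omega)
  have e2 : alg.run (i + 1) A ω (j + 1) =
      ⟨i + 1, (alg.run m A ω j).count, (alg.run m A ω j).answers⟩ := by
    rw [run_succ, e1, alg.step_of_not_asks _ _ _ (by omega) (by rw [hj]; exact has), hj]
  have e3 : ∀ k, alg.run (i + 1) A ω (j + 1 + k) =
      ⟨i + 1, (alg.run m A ω j).count, (alg.run m A ω j).answers⟩ := by
    intro k
    induction k with
    | zero => exact e2
    | succ k ih =>
      rw [← Nat.add_assoc, run_succ, ih]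
      exact alg.step_of_le _ _ _ (le_refl (i + 1))
  have hjle : j + 1 ≤ m + Q := by
    have := alg.time_add_count m A ω j (by omega)
    have := hQ j
    omega
  obtain ⟨k, hk⟩ := Nat.exists_eq_add_of_le hjle
  rw [hk, e3]
  exact ⟨rfl, hr⟩

end Run

end DynamicAlgorithm

/-! ### Joint measurability of the run in seed and stream. -/

instance Configuration.instMeasurableSpace (n : ℕ) : MeasurableSpace (Configuration n) :=
  MeasurableSpace.comap (fun s => (s.time, s.count, s.answers)) inferInstance

section Measurability

variable {n : ℕ}

theorem Configuration.measurable_toProd :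
    Measurable fun s : Configuration n => (s.time, s.count, s.answers) :=
  comap_measurable _

theorem Configuration.measurable_time : Measurable (Configuration.time (n := n)) :=
  measurable_fst.comp Configuration.measurable_toProd

theorem Configuration.measurable_count : Measurable (Configuration.count (n := n)) :=
  (measurable_fst.comp measurable_snd).comp Configuration.measurable_toProd

theorem Configuration.measurable_answers : Measurable (Configuration.answers (n := n)) :=
  (measurable_snd.comp measurable_snd).comp Configuration.measurable_toProd

theorem Configuration.measurable_mk {Y : Type*} [MeasurableSpace Y] {t c : Y → ℕ}
    {a : Y → ℕ → Fin n → ℝ} (ht : Measurable t) (hc : Measurable c) (ha : Measurable a) :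
    Measurable fun y => (⟨t y, c y, a y⟩ : Configuration n) := by
  rw [measurable_comap_iff]
  exact ht.prodMk (hc.prodMk ha)

theorem Measurable.of_nat_index {X Y Z : Type*} [MeasurableSpace X] [MeasurableSpace Y]
    [MeasurableSpace Z] {f : ℕ → X → Z} (hf : ∀ i, Measurable (f i)) {t : Y → ℕ}
    (ht : Measurable t) {g : Y → X} (hg : Measurable g) : Measurable fun y => f (t y) (g y) := by
  have : Measurable fun q : ℕ × X => f q.1 q.2 := measurable_from_prod_countable_right hf
  exact this.comp (ht.prodMk hg)

theorem Measurable.of_nat_index₂ {X Y Z : Type*} [MeasurableSpace X] [MeasurableSpace Y]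
    [MeasurableSpace Z] {f : ℕ → ℕ → X → Z} (hf : ∀ i k, Measurable (f i k)) {t c : Y → ℕ}
    (ht : Measurable t) (hc : Measurable c) {g : Y → X} (hg : Measurable g) :
    Measurable fun y => f (t y) (c y) (g y) :=
  Measurable.of_nat_index (f := fun i (q : ℕ × X) => f i q.1 q.2)
    (fun i => measurable_from_prod_countable_right (hf i)) ht (hc.prodMk hg)

theorem measurable_mulVec {k l : ℕ} {Y : Type*} [MeasurableSpace Y]
    {A : Y → Matrix (Fin k) (Fin l) ℝ} (hA : ∀ r s, Measurable fun y => A y r s)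
    {v : Y → Fin l → ℝ} (hv : Measurable v) : Measurable fun y => (A y).mulVec (v y) := by
  refine measurable_pi_lambda _ fun r => ?_
  simp only [Matrix.mulVec, dotProduct]
  exact Finset.measurable_sum _ fun s _ => (hA r s).mul ((measurable_pi_apply s).comp hv)

theorem measurable_function_update {Y Z : Type*} [MeasurableSpace Y] [MeasurableSpace Z]
    {a : Y → ℕ → Z} (ha : Measurable a) {c : Y → ℕ} (hc : Measurable c) {z : Y → Z}
    (hz : Measurable z) : Measurable fun y => Function.update (a y) (c y) (z y) := by
  refine measurable_pi_lambda _ fun k => ?_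
  simp only [Function.update_apply]
  exact Measurable.ite (measurableSet_eq_fun measurable_const hc) hz
    ((measurable_pi_apply k).comp ha)

variable {Ω : Type*} [MeasurableSpace Ω] (alg : DynamicAlgorithm Ω n)

theorem DynamicAlgorithm.measurable_step (m : ℕ) {Y : Type*} [MeasurableSpace Y]
    {A : Y → ℕ → Matrix (Fin n) (Fin n) ℝ} (hA : ∀ i r s, Measurable fun y => A y i r s)
    {ω : Y → Ω} (hω : Measurable ω) {s : Y → Configuration n} (hs : Measurable s) :
    Measurable fun y => alg.step m (A y) (ω y) (s y) := by
  have ht := Configuration.measurable_time.comp hs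
  have hc := Configuration.measurable_count.comp hs
  have ha := Configuration.measurable_answers.comp hs
  have hx : Measurable fun y => (ω y, (s y).answers) := hω.prodMk ha
  have hI : Measurable fun y => alg.index (s y).time (s y).count (ω y, (s y).answers) :=
    Measurable.of_nat_index₂ alg.measurable_index ht hc hx
  have hV : Measurable fun y => alg.vector (s y).time (s y).count (ω y, (s y).answers) :=
    Measurable.of_nat_index₂ alg.measurable_vector ht hc hx
  have hAI : ∀ r t, Measurable fun y =>
      A y (alg.index (s y).time (s y).count (ω y, (s y).answers)) r t := fun r t =>
    Measurable.of_nat_index (f := fun i y => A y i r t) (fun i => hA i r t) hI measurable_id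
  have hasks : MeasurableSet
      {y | (ω y, (s y).answers) ∈ alg.asks (s y).time (s y).count} := by
    have h := Measurable.of_nat_index₂ (f := fun i k x => x ∈ alg.asks i k)
      (fun i k => measurableSet_setOfPred.1 (alg.measurableSet_asks i k)) ht hc hx
    exact measurableSet_setOfPred.2 h
  unfold DynamicAlgorithm.step
  refine Measurable.ite (measurableSet_lt ht measurable_const) (Measurable.ite hasks ?_ ?_) hs
  · exact Configuration.measurable_mk ht (hc.add_const 1)
      (measurable_function_update ha hc (measurable_mulVec hAI hV))
  · exact Configuration.measurable_mk (ht.add_const 1) hc ha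

theorem DynamicAlgorithm.measurable_run (m : ℕ) {Y : Type*} [MeasurableSpace Y]
    {A : Y → ℕ → Matrix (Fin n) (Fin n) ℝ} (hA : ∀ i r s, Measurable fun y => A y i r s)
    {ω : Y → Ω} (hω : Measurable ω) (j : ℕ) :
    Measurable fun y => alg.run m (A y) (ω y) j := by
  induction j with
  | zero => exact measurable_const
  | succ j ih =>
    simp only [DynamicAlgorithm.run_succ]
    exact alg.measurable_step m hA hω ih

end Measurability

open Matrix

/-! ### Orthogonal projections growing by one vector. -/

section Projection

variable {N : ℕ}

/-- The normalised component of `w` that is not fixed by `p` (zero if there is none). -/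
noncomputable def newDirection (p : Matrix (Fin N) (Fin N) ℝ) (w : Fin N → ℝ) : Fin N → ℝ :=
  (√((w - p *ᵥ w) ⬝ᵥ (w - p *ᵥ w)))⁻¹ • (w - p *ᵥ w)

theorem dotProduct_newDirection (p : Matrix (Fin N) (Fin N) ℝ) (w : Fin N → ℝ) :
    newDirection p w = 0 ∨ newDirection p w ⬝ᵥ newDirection p w = 1 := by
  by_cases h : w - p *ᵥ w = 0
  · left; simp [newDirection, h]
  · right
    have h0 : (w - p *ᵥ w) ⬝ᵥ (w - p *ᵥ w) ≠ 0 := fun e => h (dotProduct_self_eq_zero.1 e)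
    have h1 : 0 ≤ (w - p *ᵥ w) ⬝ᵥ (w - p *ᵥ w) := by
      simp only [dotProduct]; exact Finset.sum_nonneg fun i _ => mul_self_nonneg _
    have h2 := Real.mul_self_sqrt h1
    have h3 : √((w - p *ᵥ w) ⬝ᵥ (w - p *ᵥ w)) ≠ 0 := by
      rw [Ne, Real.sqrt_eq_zero h1]; exact h0
    simp only [newDirection, smul_dotProduct, dotProduct_smul, smul_eq_mul]
    nth_rewrite 3 [← h2]
    field_simp

theorem newDirection_zero_right (p : Matrix (Fin N) (Fin N) ℝ) : newDirection p 0 = 0 := by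
  simp [newDirection]

/-- Enlarges the range of the projection `p` by the vector `w`. -/
noncomputable def enlarge (p : Matrix (Fin N) (Fin N) ℝ) (w : Fin N → ℝ) :
    Matrix (Fin N) (Fin N) ℝ :=
  p + vecMulVec (newDirection p w) (newDirection p w)

/-- Symmetric idempotent matrices. -/
structure IsOrthProj (p : Matrix (Fin N) (Fin N) ℝ) : Prop where
  transpose_eq : pᵀ = p
  mul_self : p * p = p

theorem isOrthProj_zero : IsOrthProj (0 : Matrix (Fin N) (Fin N) ℝ) := ⟨by simp, by simp⟩

theorem vecMulVec_mul_self {u : Fin N → ℝ} (hu : u = 0 ∨ u ⬝ᵥ u = 1) :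
    vecMulVec u u * vecMulVec u u = vecMulVec u u := by
  rcases hu with rfl | hu
  · simp
  · rw [vecMulVec_mul_vecMulVec, hu]; simp

namespace IsOrthProj

variable {p : Matrix (Fin N) (Fin N) ℝ}

theorem mulVec_newDirection (hp : IsOrthProj p) (w : Fin N → ℝ) : p *ᵥ newDirection p w = 0 := by
  rw [newDirection, mulVec_smul, mulVec_sub, mulVec_mulVec, hp.mul_self, sub_self, smul_zero]

theorem mul_vecMulVec_newDirection (hp : IsOrthProj p) (w : Fin N → ℝ) :
    p * vecMulVec (newDirection p w) (newDirection p w) = 0 := by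
  rw [mul_vecMulVec, hp.mulVec_newDirection]; simp

theorem vecMulVec_newDirection_mul (hp : IsOrthProj p) (w : Fin N → ℝ) :
    vecMulVec (newDirection p w) (newDirection p w) * p = 0 := by
  rw [vecMulVec_mul, ← hp.transpose_eq, vecMul_transpose, hp.transpose_eq, hp.mulVec_newDirection]
  simp

theorem enlarge (hp : IsOrthProj p) (w : Fin N → ℝ) : IsOrthProj (enlarge p w) where
  transpose_eq := by
    rw [_root_.enlarge, transpose_add, hp.transpose_eq, transpose_vecMulVec]
  mul_self := by
    rw [_root_.enlarge, add_mul, mul_add, mul_add, hp.mul_self, hp.mul_vecMulVec_newDirection,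
      hp.vecMulVec_newDirection_mul, vecMulVec_mul_self (dotProduct_newDirection p w), add_zero,
      zero_add]

theorem enlarge_mul (hp : IsOrthProj p) (w : Fin N → ℝ) : _root_.enlarge p w * p = p := by
  rw [_root_.enlarge, add_mul, hp.mul_self, hp.vecMulVec_newDirection_mul, add_zero]

theorem newDirection_dotProduct (hp : IsOrthProj p) (w : Fin N → ℝ) :
    newDirection p w ⬝ᵥ w = √((w - p *ᵥ w) ⬝ᵥ (w - p *ᵥ w)) := by
  have h : newDirection p w ⬝ᵥ (p *ᵥ w) = 0 := by
    rw [dotProduct_mulVec, ← mulVec_transpose, hp.transpose_eq, hp.mulVec_newDirection,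
      zero_dotProduct]
  have h' : newDirection p w ⬝ᵥ w = newDirection p w ⬝ᵥ (w - p *ᵥ w) := by
    rw [dotProduct_sub, h, sub_zero]
  rw [h', newDirection, smul_dotProduct, smul_eq_mul, inv_mul_eq_div, Real.div_sqrt]

theorem enlarge_mulVec (hp : IsOrthProj p) (w : Fin N → ℝ) : _root_.enlarge p w *ᵥ w = w := by
  rw [_root_.enlarge, add_mulVec, vecMulVec_mulVec, hp.newDirection_dotProduct]
  have h1 : 0 ≤ (w - p *ᵥ w) ⬝ᵥ (w - p *ᵥ w) := by
    simp only [dotProduct]; exact Finset.sum_nonneg fun i _ => mul_self_nonneg _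
  by_cases h : w - p *ᵥ w = 0
  · rw [h, newDirection, h]; simpa using (sub_eq_zero.1 h).symm
  · have h0 : (w - p *ᵥ w) ⬝ᵥ (w - p *ᵥ w) ≠ 0 := fun e => h (dotProduct_self_eq_zero.1 e)
    have h3 : √((w - p *ᵥ w) ⬝ᵥ (w - p *ᵥ w)) ≠ 0 := by
      rw [Ne, Real.sqrt_eq_zero h1]; exact h0
    ext i
    simp only [newDirection, Pi.add_apply, Pi.smul_apply, smul_eq_mul, MulOpposite.smul_eq_mul_unop,
      MulOpposite.unop_op, Pi.sub_apply]
    field_simp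
    ring

/-- The trace serves as the dimension of the explored space; a vector already in the range
contributes nothing. -/
theorem _root_.trace_enlarge_le (p : Matrix (Fin N) (Fin N) ℝ) (w : Fin N → ℝ) :
    (_root_.enlarge p w).trace ≤ p.trace + 1 := by
  rw [_root_.enlarge, trace_add, trace_vecMulVec]
  rcases dotProduct_newDirection p w with h | h
  · rw [h]; simp
  · rw [h]

end IsOrthProj

theorem enlarge_zero (p : Matrix (Fin N) (Fin N) ℝ) : enlarge p 0 = p := by
  simp [enlarge, newDirection_zero_right]

end Projection

/-! ### Dependence of an adaptive procedure on the explored part of the matrix. -/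

section Exploration

variable {N : ℕ} {S : Type*}

/-- The states `r G 0, r G 1, …` of a procedure that explores an unknown matrix `G` by asking, in
state `s`, for the product of `G` and `w s`. -/
structure IsExploration (r : Matrix (Fin N) (Fin N) ℝ → ℕ → S) (w : S → Fin N → ℝ) : Prop where
  zero : ∀ G G', r G 0 = r G' 0
  succ : ∀ G G' j, r G j = r G' j → G *ᵥ w (r G j) = G' *ᵥ w (r G j) → r G (j + 1) = r G' (j + 1)

/-- The orthogonal projection to the span of the first `j` queries. -/
noncomputable def exploredProj (r : Matrix (Fin N) (Fin N) ℝ → ℕ → S) (w : S → Fin N → ℝ)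
    (G : Matrix (Fin N) (Fin N) ℝ) : ℕ → Matrix (Fin N) (Fin N) ℝ
  | 0 => 0
  | j + 1 => enlarge (exploredProj r w G j) (w (r G j))

variable {r : Matrix (Fin N) (Fin N) ℝ → ℕ → S} {w : S → Fin N → ℝ}

theorem isOrthProj_exploredProj (G : Matrix (Fin N) (Fin N) ℝ) (j : ℕ) :
    IsOrthProj (exploredProj r w G j) := by
  induction j with
  | zero => exact isOrthProj_zero
  | succ j ih => exact ih.enlarge _

/-- Induction along the run: agreement on the larger span implies agreement on the smaller one,
hence equal states so far; the next query lies in the larger span, hence receives the same answer.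
-/
theorem IsExploration.congr (h : IsExploration r w) {G G' : Matrix (Fin N) (Fin N) ℝ} {j : ℕ}
    (hG : G' * exploredProj r w G j = G * exploredProj r w G j) :
    r G' j = r G j ∧ exploredProj r w G' j = exploredProj r w G j := by
  induction j with
  | zero => exact ⟨h.zero _ _, rfl⟩
  | succ j ih =>
    have hp := isOrthProj_exploredProj (r := r) (w := w) G j
    rw [exploredProj] at hG
    have hG' : G' * exploredProj r w G j = G * exploredProj r w G j := by
      rw [← hp.enlarge_mul (w (r G j)), ← Matrix.mul_assoc, hG, Matrix.mul_assoc]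
    obtain ⟨h1, h2⟩ := ih hG'
    refine ⟨(h.succ G G' j h1.symm ?_).symm, ?_⟩
    · rw [← hp.enlarge_mulVec (w (r G j)), mulVec_mulVec, mulVec_mulVec, hG]
    · rw [exploredProj, exploredProj, h1, h2]

end Exploration

open ProbabilityTheory

/-! ### Gaussian tail bounds in both directions. -/

section GaussianTail

theorem integral_Ioi_mul_exp_neg_sq_div_two :
    ∫ u in Set.Ioi (0 : ℝ), u * Real.exp (-(1 / 2) * u ^ 2) = 1 := by
  have hd : ∀ x ∈ Set.Ici (0 : ℝ), HasDerivAt (fun u : ℝ => -Real.exp (-(1 / 2) * u ^ 2))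
      (x * Real.exp (-(1 / 2) * x ^ 2)) x := by
    intro x _
    have h1 : HasDerivAt (fun u : ℝ => -(1 / 2) * u ^ 2) (-(1 / 2) * (2 * x)) x := by
      simpa using (hasDerivAt_pow 2 x).const_mul (-(1 / 2) : ℝ)
    exact h1.exp.fun_neg.congr_deriv (by ring)
  have ht : Filter.Tendsto (fun u : ℝ => -Real.exp (-(1 / 2) * u ^ 2)) Filter.atTop
      (nhds (-0)) := by
    refine (Real.tendsto_exp_atBot.comp ?_).neg
    exact Filter.Tendsto.const_mul_atTop_of_neg (by norm_num)
      (Filter.tendsto_pow_atTop (by norm_num))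
  have hi := (integrable_mul_exp_neg_mul_sq (b := 1 / 2) (by norm_num)).integrableOn
    (s := Set.Ioi (0 : ℝ))
  rw [integral_Ioi_of_hasDerivAt_of_tendsto' hd hi ht]
  simp

/-- After shifting by `x`, the density carries a factor `exp (-x * u)`. Bounding it below by its
tangent at `u = 1` leaves two explicit half-line integrals. The bound is valid down to `x = 0`,
where it gives the sharp value `1 / 2`; this is needed for all `δ₀ < 1 / 2`. -/
theorem half_exp_le_gaussianReal_Ioi {x : ℝ} (hx : 0 ≤ x) :
    ENNReal.ofReal (1 / 2 * Real.exp (-x - x ^ 2 / 2)) ≤ gaussianReal 0 1 (Set.Ioi x) := by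
  have h1 : gaussianReal 0 1 (Set.Ioi x) = gaussianReal (-x) 1 (Set.Ioi 0) := by
    have := gaussianReal_map_sub_const (μ := 0) (v := 1) x
    rw [zero_sub] at this
    rw [← this, Measure.map_apply (by fun_prop) measurableSet_Ioi]
    congr 1
    ext y
    simp
  rw [h1, gaussianReal_apply_eq_integral _ one_ne_zero]
  refine ENNReal.ofReal_le_ofReal ?_
  set C := (√(2 * Real.pi))⁻¹ with hC
  have hi1 := (integrable_exp_neg_mul_sq (b := 1 / 2) (by norm_num)).integrableOn
    (s := Set.Ioi (0 : ℝ))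
  have hi2 := (integrable_mul_exp_neg_mul_sq (b := 1 / 2) (by norm_num)).integrableOn
    (s := Set.Ioi (0 : ℝ))
  set E := C * Real.exp (-x - x ^ 2 / 2) with hE
  have hlow : ∫ u in Set.Ioi (0 : ℝ), (E * (1 + x) * Real.exp (-(1 / 2) * u ^ 2)
      - E * x * (u * Real.exp (-(1 / 2) * u ^ 2))) ≤
      ∫ u in Set.Ioi (0 : ℝ), gaussianPDFReal (-x) 1 u := by
    refine setIntegral_mono ((hi1.const_mul _).sub (hi2.const_mul _))
      (integrable_gaussianPDFReal _ _).integrableOn fun u => ?_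
    have hexp := Real.add_one_le_exp (-(x * (u - 1)))
    have e : gaussianPDFReal (-x) 1 u =
        E * Real.exp (-(1 / 2) * u ^ 2) * Real.exp (-(x * (u - 1))) := by
      rw [gaussianPDFReal, hE, hC]
      simp only [NNReal.coe_one, mul_one]
      rw [mul_assoc, mul_assoc, ← Real.exp_add, ← Real.exp_add]
      congr 2
      ring
    rw [e]
    have hE0 : 0 ≤ E * Real.exp (-(1 / 2) * u ^ 2) := by positivity
    nlinarith [mul_le_mul_of_nonneg_left hexp hE0]
  refine le_trans ?_ hlow
  rw [integral_sub (hi1.const_mul _) (hi2.const_mul _), integral_const_mul, integral_const_mul,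
    integral_Ioi_mul_exp_neg_sq_div_two, integral_gaussian_Ioi]
  have hpi : √(Real.pi / (1 / 2)) = √(2 * Real.pi) := by congr 1; ring
  rw [hpi]
  have hs : 2 ≤ √(2 * Real.pi) := by
    apply Real.le_sqrt_of_sq_le
    nlinarith [Real.pi_gt_three]
  have hCs : C * √(2 * Real.pi) = 1 := by
    rw [hC]; exact inv_mul_cancel₀ (by positivity)
  -- With this, the term linear in `x` is nonnegative and can be dropped.
  have hC2 : C ≤ 1 / 2 := by
    rw [hC, one_div]; exact inv_anti₀ (by norm_num) hs
  have e1 : E * (1 + x) * (√(2 * Real.pi) / 2) - E * x * 1 =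
      Real.exp (-x - x ^ 2 / 2) * ((C * √(2 * Real.pi)) * (1 + x) / 2 - C * x) := by
    rw [hE]; ring
  rw [e1, hCs, mul_comm]
  refine mul_le_mul_of_nonneg_left ?_ (Real.exp_pos _).le
  nlinarith

theorem integrable_exp_sq_div_four :
    Integrable (fun x : ℝ => Real.exp (1 / 4 * x ^ 2)) (gaussianReal 0 1) ∧
      ∫ x, Real.exp (1 / 4 * x ^ 2) ∂(gaussianReal 0 1) ≤ Real.exp (1 / 2) := by
  have e : ∀ x : ℝ, gaussianPDFReal 0 1 x • Real.exp (1 / 4 * x ^ 2) =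
      (√(2 * Real.pi))⁻¹ * Real.exp (-(1 / 4) * x ^ 2) := by
    intro x
    rw [gaussianPDFReal, smul_eq_mul]
    simp only [NNReal.coe_one, mul_one, sub_zero]
    rw [mul_assoc, ← Real.exp_add]
    congr 2
    ring
  constructor
  · rw [gaussianReal_of_var_ne_zero _ one_ne_zero,
      integrable_withDensity_iff_integrable_smul' (measurable_gaussianPDF _ _)
        (.of_forall fun _ => gaussianPDF_lt_top)]
    simp only [toReal_gaussianPDF, e]
    exact (integrable_exp_neg_mul_sq (by norm_num)).const_mul _
  · rw [integral_gaussianReal_eq_integral_smul one_ne_zero]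
    simp only [e]
    rw [integral_const_mul, integral_gaussian]
    have : (√(2 * Real.pi))⁻¹ * √(Real.pi / (1 / 4)) = √2 := by
      rw [← Real.sqrt_inv, ← Real.sqrt_mul (by positivity)]
      congr 1
      field_simp
      norm_num
    rw [this, Real.sqrt_le_left (Real.exp_pos _).le, ← Real.exp_nat_mul]
    norm_num
    linarith [Real.add_one_le_exp (1 : ℝ)]

/-- Chernoff's bound with parameter `1 / 4`: the coordinates are independent and each contributes a
factor `√2 ≤ exp (1 / 2)`. -/
theorem stdGaussian_norm_tail (ι : Type*) [Fintype ι] {R : ℝ} :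
    (stdGaussian (EuclideanSpace ℝ ι)).real {x | R ≤ ‖x‖ ^ 2} ≤
      Real.exp (Fintype.card ι / 2 - R / 4) := by
  classical
  have hX : Measurable fun x : EuclideanSpace ℝ ι => ‖x‖ ^ 2 := by fun_prop
  rw [← map_pi_eq_stdGaussian, map_measureReal_apply (by fun_prop)
    (measurableSet_le measurable_const hX)]
  have e : ∀ x : ι → ℝ, Real.exp (1 / 4 * ∑ i, x i ^ 2) = ∏ i, Real.exp (1 / 4 * x i ^ 2) := by
    intro x
    rw [Finset.mul_sum, Real.exp_sum]
  have hint : Integrable (fun x : ι → ℝ => Real.exp (1 / 4 * ∑ i, x i ^ 2))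
      (Measure.pi fun _ => gaussianReal 0 1) := by
    simp only [e]
    exact Integrable.fintype_prod (f := fun _ y => Real.exp (1 / 4 * y ^ 2))
      fun _ => integrable_exp_sq_div_four.1
  have h := measure_ge_le_exp_mul_mgf (μ := Measure.pi fun _ : ι => gaussianReal 0 1)
    (X := fun x => ∑ i, x i ^ 2) R (t := 1 / 4) (by norm_num) hint
  have hm : mgf (fun x : ι → ℝ => ∑ i, x i ^ 2) (Measure.pi fun _ => gaussianReal 0 1) (1 / 4) ≤
      Real.exp (1 / 2) ^ Fintype.card ι := by
    rw [mgf]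
    simp only [e]
    rw [integral_fintype_prod_eq_prod (f := fun _ y => Real.exp (1 / 4 * y ^ 2))]
    rw [Finset.prod_const, Finset.card_univ]
    exact pow_le_pow_left₀ (integral_nonneg fun _ => (Real.exp_pos _).le)
      integrable_exp_sq_div_four.2 _
  have hset : (WithLp.toLp 2 ⁻¹' {x : EuclideanSpace ℝ ι | R ≤ ‖x‖ ^ 2}) =
      {x : ι → ℝ | R ≤ ∑ i, x i ^ 2} := by
    ext x
    simp [EuclideanSpace.real_norm_sq_eq]
  rw [hset]
  refine h.trans ((mul_le_mul_of_nonneg_left hm (Real.exp_pos _).le).trans ?_)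
  rw [← Real.exp_nat_mul, ← Real.exp_add]
  apply le_of_eq
  congr 1
  ring

/-- The normalised functional `z ↦ ⟨a, z⟩ / ‖a‖` is standard normal on the line. -/
theorem stdGaussian_inner_tail {E : Type*} [NormedAddCommGroup E] [InnerProductSpace ℝ E]
    [FiniteDimensional ℝ E] [MeasurableSpace E] [BorelSpace E] {a : E} {x : ℝ} (hx : 0 ≤ x)
    (ha : a ≠ 0) :
    ENNReal.ofReal (1 / 2 * Real.exp (-x - x ^ 2 / 2)) ≤
      stdGaussian E {z | x * ‖a‖ < inner ℝ a z} := by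
  have hpos : 0 < ‖a‖ := norm_pos_iff.2 ha
  have hL := IsGaussian.map_eq_gaussianReal (μ := stdGaussian E) (innerSL ℝ (‖a‖⁻¹ • a))
  rw [integral_strongDual_stdGaussian, variance_dual_stdGaussian, innerSL_apply_norm, norm_smul,
    norm_inv, norm_norm, inv_mul_cancel₀ hpos.ne', one_pow, Real.toNNReal_one] at hL
  refine (half_exp_le_gaussianReal_Ioi hx).trans (le_of_eq ?_)
  rw [← hL, Measure.map_apply (by fun_prop) measurableSet_Ioi]
  congr 1
  ext z
  simp only [Set.mem_preimage, Set.mem_Ioi, Set.mem_ofPred_eq, innerSL_apply_apply,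
    inner_smul_left, RCLike.conj_to_real]
  rw [inv_mul_eq_div, lt_div_iff₀ hpos]

end GaussianTail

/-! ### Resampling the unexplored part of a Gaussian matrix. -/

section Resampling

/-- Square matrices with the Frobenius inner product. -/
abbrev FrobeniusSpace (N : ℕ) : Type := EuclideanSpace ℝ (Fin N × Fin N)

variable {N : ℕ}

def toMat (x : FrobeniusSpace N) : Matrix (Fin N) (Fin N) ℝ := Matrix.of fun i j => x (i, j)

def ofMat (M : Matrix (Fin N) (Fin N) ℝ) : FrobeniusSpace N := WithLp.toLp 2 fun ij => M ij.1 ij.2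

@[simp]
theorem toMat_ofMat (M : Matrix (Fin N) (Fin N) ℝ) : toMat (ofMat M) = M := rfl

theorem measurable_toMat_apply {Y : Type*} [MeasurableSpace Y] {f : Y → FrobeniusSpace N}
    (hf : Measurable f) (i j : Fin N) : Measurable fun y => toMat (f y) i j := by
  unfold toMat
  simp only [of_apply]
  fun_prop

theorem measurable_ofMat {Y : Type*} [MeasurableSpace Y] {f : Y → Matrix (Fin N) (Fin N) ℝ}
    (hf : ∀ i j, Measurable fun y => f y i j) : Measurable fun y => ofMat (f y) := by
  unfold ofMat
  exact (WithLp.measurable_toLp 2 _).comp (measurable_pi_lambda _ fun ij => hf ij.1 ij.2)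

theorem measurable_mul_apply {a b c : ℕ} {Y : Type*} [MeasurableSpace Y]
    {f : Y → Matrix (Fin a) (Fin b) ℝ} {g : Y → Matrix (Fin b) (Fin c) ℝ}
    (hf : ∀ i j, Measurable fun y => f y i j) (hg : ∀ i j, Measurable fun y => g y i j)
    (i : Fin a) (j : Fin c) : Measurable fun y => (f y * g y) i j := by
  simp only [Matrix.mul_apply]
  exact Finset.measurable_sum _ fun k _ => (hf i k).mul (hg k j)

theorem inner_eq_trace (x y : FrobeniusSpace N) :
    inner ℝ x y = (toMat x * (toMat y)ᵀ).trace := by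
  simp [PiLp.inner_apply, Matrix.trace, Matrix.mul_apply, toMat, Fintype.sum_prod_type, mul_comm]

theorem norm_sq_eq_trace (x : FrobeniusSpace N) :
    ‖x‖ ^ 2 = (toMat x * (toMat x)ᵀ).trace := by
  rw [← inner_eq_trace, real_inner_self_eq_norm_sq]

/-- Keeps the part of `G` on the range of `p`, and takes the remaining part from `Z`. -/
def splice (p G Z : Matrix (Fin N) (Fin N) ℝ) : Matrix (Fin N) (Fin N) ℝ := G * p + Z * (1 - p)

theorem measurable_splice_apply {Y : Type*} [MeasurableSpace Y]
    {p f g : Y → Matrix (Fin N) (Fin N) ℝ} (hp : ∀ i j, Measurable fun y => p y i j)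
    (hf : ∀ i j, Measurable fun y => f y i j) (hg : ∀ i j, Measurable fun y => g y i j)
    (i j : Fin N) : Measurable fun y => splice (p y) (f y) (g y) i j := by
  unfold splice
  simp only [Matrix.add_apply]
  refine (measurable_mul_apply hf hp i j).add (measurable_mul_apply hg (fun k l => ?_) i j)
  simp only [Matrix.sub_apply]
  exact measurable_const.sub (hp k l)

theorem splice_mul {p : Matrix (Fin N) (Fin N) ℝ} (hp : IsOrthProj p)
    (G Z : Matrix (Fin N) (Fin N) ℝ) : splice p G Z * p = G * p := by
  rw [splice, add_mul, Matrix.mul_assoc, Matrix.mul_assoc, hp.mul_self, sub_mul, one_mul,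
    hp.mul_self, sub_self, mul_zero, add_zero]

/-- A standard Gaussian matrix spliced with an independent one is standard Gaussian. -/
theorem map_splice_stdGaussian {p : Matrix (Fin N) (Fin N) ℝ} (hp : IsOrthProj p) :
    ((stdGaussian (FrobeniusSpace N)).prod (stdGaussian (FrobeniusSpace N))).map
      (fun q => ofMat (splice p (toMat q.1) (toMat q.2))) = stdGaussian (FrobeniusSpace N) := by
  have hmeas : Measurable fun q : FrobeniusSpace N × FrobeniusSpace N =>
      ofMat (splice p (toMat q.1) (toMat q.2)) :=
    measurable_ofMat (measurable_splice_apply (fun _ _ => measurable_const)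
      (measurable_toMat_apply measurable_fst) (measurable_toMat_apply measurable_snd))
  have := Measure.isProbabilityMeasure_map (μ := (stdGaussian (FrobeniusSpace N)).prod
    (stdGaussian (FrobeniusSpace N))) hmeas.aemeasurable
  apply Measure.ext_of_charFun
  ext t
  rw [charFun_apply, integral_map hmeas.aemeasurable (by fun_prop)]
  -- The pairing splits into one term for each independent factor, so the characteristic function is
  -- a product.
  have hin : ∀ q : FrobeniusSpace N × FrobeniusSpace N,
      inner ℝ (ofMat (splice p (toMat q.1) (toMat q.2))) t =
        inner ℝ q.1 (ofMat (toMat t * p)) + inner ℝ q.2 (ofMat (toMat t * (1 - p))) := by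
    intro q
    simp only [inner_eq_trace, toMat_ofMat, splice, add_mul, Matrix.trace_add, transpose_mul,
      transpose_sub, transpose_one, hp.transpose_eq, Matrix.mul_assoc]
  simp_rw [hin, Complex.ofReal_add, add_mul, Complex.exp_add]
  rw [integral_prod_mul (fun y : FrobeniusSpace N =>
      Complex.exp (↑(inner ℝ y (ofMat (toMat t * p))) * Complex.I))
    (fun y : FrobeniusSpace N =>
      Complex.exp (↑(inner ℝ y (ofMat (toMat t * (1 - p)))) * Complex.I)),
    ← charFun_apply, ← charFun_apply, charFun_stdGaussian, charFun_stdGaussian,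
    charFun_stdGaussian, ← Complex.exp_add]
  -- Pythagoras for the orthogonal decomposition of `toMat t` by `p` and `1 - p`.
  have hnorm : ‖ofMat (toMat t * p)‖ ^ 2 + ‖ofMat (toMat t * (1 - p))‖ ^ 2 = ‖t‖ ^ 2 := by
    simp only [norm_sq_eq_trace, toMat_ofMat, transpose_mul, transpose_sub, transpose_one,
      hp.transpose_eq]
    rw [← Matrix.trace_add]
    congr 1
    calc _ = toMat t * (p * p + (1 - p) * (1 - p)) * (toMat t)ᵀ := by noncomm_ring
      _ = toMat t * (toMat t)ᵀ := by
        have : p * p + (1 - p) * (1 - p) = 1 := by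
          rw [sub_mul, mul_sub, mul_sub, hp.mul_self]; noncomm_ring
        rw [this, Matrix.mul_one]
  rw [← Complex.ofReal_pow ‖t‖, ← hnorm]
  congr 1
  push_cast
  ring

theorem lintegral_splice {p : Matrix (Fin N) (Fin N) ℝ} (hp : IsOrthProj p)
    {F : FrobeniusSpace N → ENNReal} (hF : Measurable F) :
    ∫⁻ x, ∫⁻ z, F (ofMat (splice p (toMat x) (toMat z))) ∂stdGaussian _ ∂stdGaussian _ =
      ∫⁻ x, F x ∂stdGaussian (FrobeniusSpace N) := by
  have hmeas : Measurable fun q : FrobeniusSpace N × FrobeniusSpace N =>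
      ofMat (splice p (toMat q.1) (toMat q.2)) :=
    measurable_ofMat (measurable_splice_apply (fun _ _ => measurable_const)
      (measurable_toMat_apply measurable_fst) (measurable_toMat_apply measurable_snd))
  rw [← map_splice_stdGaussian hp, lintegral_map hF hmeas, map_splice_stdGaussian hp]
  exact (lintegral_prod _ (hF.comp hmeas).aemeasurable).symm

variable {S : Type*} {r : Matrix (Fin N) (Fin N) ℝ → ℕ → S}
  {w : S → Fin N → ℝ}

/-- Resampling outside the explored span is invisible to the procedure. -/
theorem IsExploration.splice (h : IsExploration r w) (G Z : Matrix (Fin N) (Fin N) ℝ) (j : ℕ) :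
    r (splice (exploredProj r w G j) G Z) j = r G j ∧
      exploredProj r w (_root_.splice (exploredProj r w G j) G Z) j = exploredProj r w G j :=
  h.congr (splice_mul (isOrthProj_exploredProj G j) G Z)

variable [MeasurableSpace S]

theorem measurable_newDirection {Y : Type*} [MeasurableSpace Y] {p : Y → Matrix (Fin N) (Fin N) ℝ}
    (hp : ∀ i j, Measurable fun y => p y i j) {v : Y → Fin N → ℝ} (hv : Measurable v) :
    Measurable fun y => newDirection (p y) (v y) := by
  have h : Measurable fun y => v y - p y *ᵥ v y := hv.sub (measurable_mulVec hp hv)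
  have h' : Measurable fun y => (v y - p y *ᵥ v y) ⬝ᵥ (v y - p y *ᵥ v y) := by
    simp only [dotProduct]
    exact Finset.measurable_sum _ fun i _ =>
      ((measurable_pi_apply i).comp h).mul ((measurable_pi_apply i).comp h)
  unfold newDirection
  exact h'.sqrt.inv.smul h

theorem measurable_exploredProj (hw : Measurable w)
    (hr : ∀ j, Measurable fun x : FrobeniusSpace N => r (toMat x) j) (j : ℕ) (i k : Fin N) :
    Measurable fun x : FrobeniusSpace N => exploredProj r w (toMat x) j i k := by
  induction j generalizing i k with
  | zero => exact measurable_const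
  | succ j ih =>
    have hu := measurable_newDirection ih (hw.comp (hr j))
    simp only [exploredProj, enlarge, Matrix.add_apply, vecMulVec_apply]
    exact (ih i k).add (((measurable_pi_apply i).comp hu).mul ((measurable_pi_apply k).comp hu))

/-- Resampling the part of a standard Gaussian matrix that has not been explored does not change
its distribution. -/
theorem lintegral_splice_exploredProj (h : IsExploration r w) (hw : Measurable w)
    (hr : ∀ j, Measurable fun x : FrobeniusSpace N => r (toMat x) j) (j : ℕ)
    {F : FrobeniusSpace N → ENNReal} (hF : Measurable F) :
    ∫⁻ x, ∫⁻ z, F (ofMat (_root_.splice (exploredProj r w (toMat x) j) (toMat x) (toMat z)))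
        ∂stdGaussian _ ∂stdGaussian _ = ∫⁻ x, F x ∂stdGaussian (FrobeniusSpace N) := by
  have hP := measurable_exploredProj hw hr
  have hmeas : ∀ j, Measurable fun q : FrobeniusSpace N × FrobeniusSpace N =>
      ofMat (_root_.splice (exploredProj r w (toMat q.1) j) (toMat q.1) (toMat q.2)) := fun j =>
    measurable_ofMat (measurable_splice_apply (fun i k => (hP j i k).comp measurable_fst)
      (measurable_toMat_apply measurable_fst) (measurable_toMat_apply measurable_snd))
  induction j generalizing F with
  | zero => simp [exploredProj, _root_.splice, ofMat, toMat]
  | succ j ih =>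
    have hΨ : Measurable fun x : FrobeniusSpace N => ∫⁻ z, F (ofMat
        (_root_.splice (exploredProj r w (toMat x) (j + 1)) (toMat x) (toMat z)))
        ∂stdGaussian (FrobeniusSpace N) :=
      (hF.comp (hmeas (j + 1))).lintegral_prod_right'
    -- The induction hypothesis is used for both sides, so that both start with a resampling outside
    -- the span of the first `j` queries. It remains to compare them for fixed `x`, where the next
    -- direction `u` is deterministic.
    rw [← ih hΨ, ← ih hF]
    refine lintegral_congr fun x => ?_
    set p := exploredProj r w (toMat x) j with hp
    have hpp : IsOrthProj p := isOrthProj_exploredProj _ _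
    set u := newDirection p (w (r (toMat x) j)) with hu
    have hq : IsOrthProj (vecMulVec u u) :=
      ⟨transpose_vecMulVec _ _, vecMulVec_mul_self (dotProduct_newDirection p _)⟩
    have hup : vecMulVec u u * p = 0 := hpp.vecMulVec_newDirection_mul _
    have hpu : p * vecMulVec u u = 0 := hpp.mul_vecMulVec_newDirection _
    have hF' : Measurable fun y : FrobeniusSpace N =>
        F (ofMat (_root_.splice p (toMat x) (toMat y))) :=
      hF.comp ((hmeas j).comp measurable_prodMk_left)
    -- The fresh matrix `y` may be resampled outside the fixed line spanned by `u`. The resulting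
    -- matrix agrees pointwise with that from one further step of exploration.
    rw [← lintegral_splice hq hF']
    refine lintegral_congr fun y => lintegral_congr fun z => ?_
    obtain ⟨h1, h2⟩ := h.splice (toMat x) (toMat y) j
    rw [← hp] at h1 h2
    have h3 : exploredProj r w (_root_.splice p (toMat x) (toMat y)) (j + 1) =
        p + vecMulVec u u := by
      rw [exploredProj, h1, h2, enlarge]
    rw [toMat_ofMat, h3, toMat_ofMat]
    congr 2
    simp only [_root_.splice]
    calc _ = toMat x * (p * p + p * vecMulVec u u) +
          toMat y * (p - p * p + vecMulVec u u - p * vecMulVec u u) +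
          toMat z * (1 - p - vecMulVec u u) := by noncomm_ring
      _ = toMat x * p + toMat y * (vecMulVec u u - vecMulVec u u * p) +
          toMat z * (1 - p - vecMulVec u u + vecMulVec u u * p) := by
        rw [hpp.mul_self, hup, hpu]; noncomm_ring
      _ = _ := by noncomm_ring

end Resampling

/-! ### Queries and errors within one block of the stream. -/

section Block

variable {Ω : Type*} [MeasurableSpace Ω] {N n : ℕ}

theorem measurable_corner_apply {Y : Type*} [MeasurableSpace Y] (h : N ≤ n)
    {f : Y → Matrix (Fin N) (Fin N) ℝ} (hf : ∀ i j, Measurable fun y => f y i j) (i j : Fin n) :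
    Measurable fun y => corner h (f y) i j := by
  unfold corner
  exact measurable_mul_apply (f := fun y => inclusionMatrix h * f y)
    (g := fun _ => (inclusionMatrix h)ᵀ)
    (measurable_mul_apply (f := fun _ => inclusionMatrix h) (fun _ _ => measurable_const) hf)
    (fun _ _ => measurable_const) i j

open Classical in
/-- The stream that consists of multiples of `corner h G` at the time steps in `I` and agrees
with `B` elsewhere. -/
noncomputable def blockStream (h : N ≤ n) (c : ℕ → ℝ) (I : Set ℕ)
    (B : ℕ → Matrix (Fin n) (Fin n) ℝ) (G : Matrix (Fin N) (Fin N) ℝ) (i : ℕ) :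
    Matrix (Fin n) (Fin n) ℝ :=
  if i ∈ I then c i • corner h G else B i

theorem measurable_blockStream_apply {Y : Type*} [MeasurableSpace Y] (h : N ≤ n) (c : ℕ → ℝ)
    (I : Set ℕ) (B : ℕ → Matrix (Fin n) (Fin n) ℝ) {f : Y → Matrix (Fin N) (Fin N) ℝ}
    (hf : ∀ i j, Measurable fun y => f y i j) (k : ℕ) (i j : Fin n) :
    Measurable fun y => blockStream h c I B (f y) k i j := by
  unfold blockStream
  split_ifs
  · simp only [Matrix.smul_apply, smul_eq_mul]
    exact (measurable_corner_apply h hf i j).const_mul _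
  · exact measurable_const

theorem blockStream_smul (h : N ≤ n) (c : ℕ → ℝ) (I : Set ℕ) (B : ℕ → Matrix (Fin n) (Fin n) ℝ)
    (s : ℝ) (G : Matrix (Fin N) (Fin N) ℝ) :
    blockStream h c I B (s • G) = blockStream h (fun i => c i * s) I B G := by
  funext i
  simp only [blockStream, corner_smul, smul_smul]

namespace DynamicAlgorithm

variable (alg : DynamicAlgorithm Ω n) (h : N ≤ n)

open Classical in
/-- The coordinates of the next query vector that matter for the matrices in the block `I` (zero if
the next move is not a query to this block). -/
noncomputable def blockQuery (I : Set ℕ) (M : ℕ) (ω : Ω) (s : Configuration n) : Fin N → ℝ :=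
  if s.time < M ∧ (ω, s.answers) ∈ alg.asks s.time s.count ∧
      alg.index s.time s.count (ω, s.answers) ∈ I then
    (inclusionMatrix h)ᵀ *ᵥ alg.vector s.time s.count (ω, s.answers)
  else 0

theorem measurable_blockQuery (I : Set ℕ) (M : ℕ) (ω : Ω) :
    Measurable (alg.blockQuery h I M ω) := by
  have ht := Configuration.measurable_time (n := n)
  have hc := Configuration.measurable_count (n := n)
  have hx : Measurable fun s : Configuration n => (ω, s.answers) :=
    measurable_const.prodMk Configuration.measurable_answers
  have hI : Measurable fun s : Configuration n => alg.index s.time s.count (ω, s.answers) :=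
    Measurable.of_nat_index₂ alg.measurable_index ht hc hx
  have hV : Measurable fun s : Configuration n => alg.vector s.time s.count (ω, s.answers) :=
    Measurable.of_nat_index₂ alg.measurable_vector ht hc hx
  have hasks : MeasurableSet
      {s : Configuration n | (ω, s.answers) ∈ alg.asks s.time s.count} := by
    have h := Measurable.of_nat_index₂ (f := fun i k x => x ∈ alg.asks i k)
      (fun i k => measurableSet_setOfPred.1 (alg.measurableSet_asks i k)) ht hc hx
    exact measurableSet_setOfPred.2 h
  unfold blockQuery
  refine Measurable.ite ?_ (measurable_mulVec (A := fun _ => (inclusionMatrix h)ᵀ)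
    (fun _ _ => measurable_const) hV) measurable_const
  exact (measurableSet_lt ht measurable_const).inter
    (hasks.inter (hI (MeasurableSet.of_discrete (s := I))))

/-- Answers about matrices outside the block do not involve `G`; answers inside it are determined by
`G` times the first `N` coordinates of the query vector. -/
theorem isExploration_run (c : ℕ → ℝ) (I : Set ℕ) (B : ℕ → Matrix (Fin n) (Fin n) ℝ) (M : ℕ)
    (ω : Ω) : IsExploration (fun G => alg.run M (blockStream h c I B G) ω)
      (alg.blockQuery h I M ω) where
  zero _ _ := rfl
  succ G G' j hr hG := by
    change alg.run M (blockStream h c I B G) ω j = alg.run M (blockStream h c I B G') ω j at hr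
    rw [run_succ, run_succ, ← hr]
    set s := alg.run M (blockStream h c I B G) ω j
    rcases le_or_gt M s.time with ht | ht
    · rw [alg.step_of_le _ _ _ ht, alg.step_of_le _ _ _ ht]
    by_cases hs : (ω, s.answers) ∈ alg.asks s.time s.count
    · rw [alg.step_of_asks _ _ _ ht hs, alg.step_of_asks _ _ _ ht hs]
      congr 2
      by_cases hI : alg.index s.time s.count (ω, s.answers) ∈ I
      · rw [blockQuery, if_pos ⟨ht, hs, hI⟩] at hG
        simp only [blockStream, if_pos hI, corner, smul_mulVec, ← mulVec_mulVec, hG]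
      · simp only [blockStream, if_neg hI]
    · rw [alg.step_of_not_asks _ _ _ ht hs, alg.step_of_not_asks _ _ _ ht hs]

/-- Before time `E` no matrix of the block has arrived, so nothing is explored; afterwards each
query adds at most one dimension. -/
theorem trace_exploredProj_add_count_le (c : ℕ → ℝ) {I : Set ℕ}
    (B : ℕ → Matrix (Fin n) (Fin n) ℝ) {E M : ℕ} (hEM : E ≤ M) (hI : ∀ i < E, i ∉ I) (ω : Ω)
    (G : Matrix (Fin N) (Fin N) ℝ) (j : ℕ) :
    (exploredProj (fun G => alg.run M (blockStream h c I B G) ω) (alg.blockQuery h I M ω) G j).trace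
      + (alg.run E (blockStream h c I B G) ω j).count ≤
      (alg.run M (blockStream h c I B G) ω j).count := by
  set A := blockStream h c I B G with hA
  set p := exploredProj (fun G => alg.run M (blockStream h c I B G) ω) (alg.blockQuery h I M ω) G
    with hp
  have hpsucc : ∀ j, p (j + 1) = enlarge (p j) (alg.blockQuery h I M ω (alg.run M A ω j)) :=
    fun j => rfl
  -- The two phases of the induction: the runs still coincide and nothing is explored, or the run
  -- with horizon `E` is frozen.
  suffices (alg.run E A ω j = alg.run M A ω j ∧ p j = 0) ∨
      (E ≤ (alg.run E A ω j).time ∧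
        (p j).trace + (alg.run E A ω j).count ≤ (alg.run M A ω j).count) by
    rcases this with ⟨h1, h2⟩ | h1
    · rw [h1, h2]; simp
    · exact h1.2
  induction j with
  | zero => exact .inl ⟨rfl, rfl⟩
  | succ j ih =>
    by_cases hE : (alg.run E A ω j).time < E
    · obtain ⟨h1, h2⟩ := ih.resolve_right fun h => by omega
      left
      rw [h1] at hE
      refine ⟨?_, ?_⟩
      · rw [run_succ, run_succ, h1]
        exact alg.step_eq_of_lt A ω hE (hE.trans_le hEM)
      · have hw : alg.blockQuery h I M ω (alg.run M A ω j) = 0 := by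
          rw [blockQuery, if_neg]
          rintro ⟨-, -, h3⟩
          exact hI _ ((alg.index_le _ _ _).trans_lt hE) h3
        rw [hpsucc, hw, enlarge_zero, h2]
    · right
      rw [not_lt] at hE
      have e1 : alg.run E A ω (j + 1) = alg.run E A ω j := by rw [run_succ, alg.step_of_le _ _ _ hE]
      have ih' : (p j).trace + (alg.run E A ω j).count ≤ (alg.run M A ω j).count := by
        rcases ih with ⟨h1, h2⟩ | h1
        · rw [h1, h2]; simp
        · exact h1.2
      refine ⟨e1 ▸ hE, ?_⟩
      rw [e1, hpsucc]
      set s := alg.run M A ω j with hs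
      by_cases hask : s.time < M ∧ (ω, s.answers) ∈ alg.asks s.time s.count
      · rw [run_succ, ← hs, alg.step_of_asks _ _ _ hask.1 hask.2]
        have := trace_enlarge_le (p j) (alg.blockQuery h I M ω s)
        push_cast
        linarith
      · have hw : alg.blockQuery h I M ω s = 0 := by
          rw [blockQuery, if_neg]
          rintro ⟨h1, h2, -⟩
          exact hask ⟨h1, h2⟩
        rw [hw, enlarge_zero]
        have : (s.count : ℝ) ≤ (alg.run M A ω (j + 1)).count := by
          exact_mod_cast alg.count_le_count_succ M A ω j
        linarith

/-- After `J` moves, the algorithm has finished time step `t`, and its estimate at this time step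
is within `ε` of `x`. -/
def Estimates (A : ℕ → Matrix (Fin n) (Fin n) ℝ) (ω : Ω) (J t : ℕ) (x ε : ℝ) : Prop :=
  (alg.run (t + 1) A ω J).time = t + 1 ∧
    |alg.report t (alg.run (t + 1) A ω J).count (ω, (alg.run (t + 1) A ω J).answers) - x| ≤ ε

theorem measurableSet_estimates {Y : Type*} [MeasurableSpace Y]
    {A : Y → ℕ → Matrix (Fin n) (Fin n) ℝ} (hA : ∀ i r s, Measurable fun y => A y i r s)
    {ω : Y → Ω} (hω : Measurable ω) (J t : ℕ) {x : Y → ℝ} (hx : Measurable x) (ε : ℝ) :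
    MeasurableSet {y | alg.Estimates (A y) (ω y) J t (x y) ε} := by
  have hr := alg.measurable_run (t + 1) hA hω J
  have ht := Configuration.measurable_time.comp hr
  have hc := Configuration.measurable_count.comp hr
  have ha := Configuration.measurable_answers.comp hr
  have hR : Measurable fun y => alg.report t (alg.run (t + 1) (A y) (ω y) J).count
      (ω y, (alg.run (t + 1) (A y) (ω y) J).answers) :=
    Measurable.of_nat_index (alg.measurable_report t) hc (hω.prodMk ha)
  exact (measurableSet_eq_fun ht measurable_const).inter
    (measurableSet_le (hR.sub hx).norm measurable_const)

/-- For a random matrix `T` of law `ν`, an algorithm that makes at most `k` queries in the block of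
`T` fails to estimate its trace with probability at least `ρ`, up to an error `τ`. -/
def IsHardBlock {X : Type*} [MeasurableSpace X] (ν : Measure X) (T : X → Matrix (Fin N) (Fin N) ℝ)
    (k : ℕ) (ε : ℝ) (ρ τ : ENNReal) : Prop :=
  ∀ (c : ℕ → ℝ) (I : Set ℕ) (B : ℕ → Matrix (Fin n) (Fin n) ℝ) (ω : Ω) (E t J : ℕ),
    E ≤ t + 1 → (∀ i < E, i ∉ I) →
    ρ * ν {x | (alg.run (t + 1) (blockStream h c I B (T x)) ω J).count ≤
        (alg.run E (blockStream h c I B (T x)) ω J).count + k} ≤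
      ν {x | ¬ alg.Estimates (blockStream h c I B (T x)) ω J t (T x).trace ε} + τ

/-- Given the explored part, the report is a constant, while the trace still contains a normal
variable of standard deviation at least `s * √(N - k)`. It exceeds `ε` in the direction away from
the report with the stated probability. -/
theorem gaussian_block (c : ℕ → ℝ) {I : Set ℕ} (B : ℕ → Matrix (Fin n) (Fin n) ℝ) (ω : Ω)
    {E t J : ℕ} (hE : E ≤ t + 1) (hI : ∀ i < E, i ∉ I) {s y ε : ℝ} {k : ℕ} (hs : 0 < s)
    (hy : 0 ≤ y) (hk : k < N) (hε : ε ≤ s * (y * √(N - k))) :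
    ENNReal.ofReal (1 / 2 * Real.exp (-y - y ^ 2 / 2)) * stdGaussian (FrobeniusSpace N)
      {x | (alg.run (t + 1) (blockStream h c I B (s • toMat x)) ω J).count ≤
        (alg.run E (blockStream h c I B (s • toMat x)) ω J).count + k} ≤
      stdGaussian (FrobeniusSpace N)
        {x | ¬ alg.Estimates (blockStream h c I B (s • toMat x)) ω J t (s • toMat x).trace ε} := by
  -- The scale moves into the coefficients, so that the explored matrix is standard Gaussian.
  simp only [blockStream_smul]
  set c' : ℕ → ℝ := fun i => c i * s
  set ρ := ENNReal.ofReal (1 / 2 * Real.exp (-y - y ^ 2 / 2)) with hρ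
  set r := fun G => alg.run (t + 1) (blockStream h c' I B G) ω with hr
  set w : Configuration n → Fin N → ℝ := alg.blockQuery h I (t + 1) ω with hw
  have hex : IsExploration r w := alg.isExploration_run h c' I B (t + 1) ω
  have hmA : ∀ k i j, Measurable fun x : FrobeniusSpace N =>
      blockStream h c' I B (toMat x) k i j :=
    measurable_blockStream_apply h c' I B (measurable_toMat_apply measurable_id)
  have hrm : ∀ M j, Measurable fun x : FrobeniusSpace N =>
      alg.run M (blockStream h c' I B (toMat x)) ω j := fun M j =>
    alg.measurable_run M hmA measurable_const j
  have hmtr : Measurable fun x : FrobeniusSpace N => (s • toMat x).trace := by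
    simp only [Matrix.trace, Matrix.diag, Matrix.smul_apply, smul_eq_mul]
    exact Finset.measurable_sum _ fun i _ =>
      (measurable_toMat_apply measurable_id i i).const_mul _
  set bad := {x : FrobeniusSpace N |
    ¬ alg.Estimates (blockStream h c' I B (toMat x)) ω J t (s • toMat x).trace ε} with hbad
  have hbadm : MeasurableSet bad :=
    (alg.measurableSet_estimates hmA measurable_const J t hmtr ε).compl
  set few := {x : FrobeniusSpace N | (alg.run (t + 1) (blockStream h c' I B (toMat x)) ω J).count ≤
        (alg.run E (blockStream h c' I B (toMat x)) ω J).count + k} with hfew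
  have hfewm : MeasurableSet few :=
    measurableSet_le (Configuration.measurable_count.comp (hrm _ _))
      ((Configuration.measurable_count.comp (hrm _ _)).add_const k)
  -- The error probability becomes an average over resampled matrices; for each `x` in `few` the
  -- inner average is bounded below by `ρ`.
  rw [← lintegral_indicator_one hbadm, ← lintegral_splice_exploredProj hex
    (alg.measurable_blockQuery h I (t + 1) ω) (hrm _) J (measurable_one.indicator hbadm),
    ← lintegral_indicator_const hfewm]
  refine lintegral_mono fun x => ?_
  by_cases hx : x ∈ few
  swap
  · rw [Set.indicator_of_notMem hx]; exact zero_le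
  rw [Set.indicator_of_mem hx]
  set p := exploredProj r w (toMat x) J with hp
  have hpp : IsOrthProj p := isOrthProj_exploredProj _ _
  have hrun : ∀ z, alg.run (t + 1) (blockStream h c' I B (splice p (toMat x) (toMat z))) ω J =
      alg.run (t + 1) (blockStream h c' I B (toMat x)) ω J := fun z =>
    (hex.splice (toMat x) (toMat z) J).1
  have htr : p.trace ≤ k := by
    have h1 := alg.trace_exploredProj_add_count_le h c' B hE hI ω (toMat x) J
    have h2 : ((alg.run (t + 1) (blockStream h c' I B (toMat x)) ω J).count : ℝ) ≤
        (alg.run E (blockStream h c' I B (toMat x)) ω J).count + k := by exact_mod_cast hx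
    have h3 := h1.trans h2
    rw [add_comm] at h3
    exact le_of_add_le_add_left h3
  set a : FrobeniusSpace N := ofMat (1 - p) with ha
  have hanorm : ‖a‖ ^ 2 = N - p.trace := by
    rw [norm_sq_eq_trace, ha, toMat_ofMat, transpose_sub, transpose_one, hpp.transpose_eq, sub_mul,
      one_mul, mul_sub, mul_one, hpp.mul_self, sub_self, sub_zero, trace_sub, trace_one,
      Fintype.card_fin]
  have hkN : (k : ℝ) < N := by exact_mod_cast hk
  have hale : √(N - k) ≤ ‖a‖ := by
    rw [Real.sqrt_le_left (norm_nonneg _), hanorm]; linarith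
  have ha0 : a ≠ 0 := by
    intro h0
    rw [h0, norm_zero] at hanorm
    norm_num at hanorm
    linarith
  have hain : ∀ z, inner ℝ a z = (toMat z * (1 - p)).trace := by
    intro z
    rw [real_inner_comm, inner_eq_trace, ha, toMat_ofMat, transpose_sub, transpose_one,
      hpp.transpose_eq]
  set R := alg.report t (alg.run (t + 1) (blockStream h c' I B (toMat x)) ω J).count
    (ω, (alg.run (t + 1) (blockStream h c' I B (toMat x)) ω J).answers) with hR
  have hεa : ε ≤ s * (y * ‖a‖) :=
    hε.trans (mul_le_mul_of_nonneg_left (mul_le_mul_of_nonneg_left hale hy) hs.le)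
  have hmem : ∀ z, ε < |R - s * ((toMat x * p).trace + inner ℝ a z)| →
      ofMat (splice p (toMat x) (toMat z)) ∈ bad := by
    intro z hz
    rw [hbad, Set.mem_ofPred_eq, toMat_ofMat, Estimates, hrun z, ← hR]
    rintro ⟨-, h2⟩
    rw [trace_smul, splice, trace_add, ← hain, smul_eq_mul] at h2
    exact absurd h2 (not_le.2 hz)
  have key : ∀ U : Set (FrobeniusSpace N), MeasurableSet U →
      (∀ z ∈ U, ofMat (splice p (toMat x) (toMat z)) ∈ bad) →
      stdGaussian (FrobeniusSpace N) U ≤ ∫⁻ z, bad.indicator 1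
        (ofMat (splice p (toMat x) (toMat z))) ∂stdGaussian (FrobeniusSpace N) := by
    intro U hU hUb
    rw [← lintegral_indicator_one hU]
    refine lintegral_mono fun z => ?_
    by_cases hz : z ∈ U
    · rw [Set.indicator_of_mem hz, Set.indicator_of_mem (hUb z hz)]; rfl
    · rw [Set.indicator_of_notMem hz]; exact zero_le
  have hinm : ∀ b : FrobeniusSpace N, Measurable fun z : FrobeniusSpace N => (inner ℝ b z : ℝ) :=
    fun b => by fun_prop
  -- A one-sided tail suffices: the noise is taken with the sign that moves the trace away from `R`.
  rcases le_total R (s * (toMat x * p).trace) with hle | hle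
  · refine (stdGaussian_inner_tail hy ha0).trans
      (key _ (measurableSet_lt measurable_const (hinm a)) fun z hz => hmem z ?_)
    have hz' : s * (y * ‖a‖) < s * inner ℝ a z := mul_lt_mul_of_pos_left hz hs
    rw [abs_sub_comm]
    refine lt_of_lt_of_le ?_ (le_abs_self _)
    rw [mul_add]
    linarith
  · refine (stdGaussian_inner_tail hy (neg_ne_zero.2 ha0)).trans
      (key _ (measurableSet_lt measurable_const (hinm (-a))) fun z hz => hmem z ?_)
    have hz' : s * (y * ‖-a‖) < s * inner ℝ (-a) z := mul_lt_mul_of_pos_left hz hs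
    rw [norm_neg, inner_neg_left, mul_neg] at hz'
    refine lt_of_lt_of_le ?_ (le_abs_self _)
    rw [mul_add]
    linarith

end DynamicAlgorithm

end Block

/-! ### The two hard distributions: truncated Gaussians and random signs. -/

section Hard

variable {Ω : Type*} [MeasurableSpace Ω] {N n : ℕ}

open Classical in
/-- A rescaled Gaussian matrix, replaced by zero if its Frobenius norm is large. -/
noncomputable def truncatedMat (s : ℝ) (x : FrobeniusSpace N) : Matrix (Fin N) (Fin N) ℝ :=
  if 4 * (N : ℝ) ^ 2 ≤ ‖x‖ ^ 2 then 0 else s • toMat x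

theorem measurable_truncatedMat_apply (s : ℝ) (i j : Fin N) :
    Measurable fun x : FrobeniusSpace N => truncatedMat s x i j := by
  have hX : Measurable fun x : FrobeniusSpace N => ‖x‖ ^ 2 := by fun_prop
  have : (fun x : FrobeniusSpace N => truncatedMat s x i j) = fun x =>
      {x : FrobeniusSpace N | 4 * (N : ℝ) ^ 2 ≤ ‖x‖ ^ 2}.piecewise (fun _ => 0)
        (fun x => s * toMat x i j) x := by
    funext x
    by_cases hx : 4 * (N : ℝ) ^ 2 ≤ ‖x‖ ^ 2 <;> simp [truncatedMat, Set.piecewise, hx]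
  rw [this]
  exact Measurable.piecewise (measurableSet_le measurable_const hX) measurable_const
    ((measurable_toMat_apply measurable_id i j).const_mul s)

theorem sqrt_sum_sq_truncatedMat_le {s : ℝ} (hs : 0 ≤ s) (x : FrobeniusSpace N) :
    √(∑ i, ∑ j, truncatedMat s x i j ^ 2) ≤ s * (2 * N) := by
  have h0 : 0 ≤ s * (2 * N) := by positivity
  rw [Real.sqrt_le_left h0]
  by_cases hx : 4 * (N : ℝ) ^ 2 ≤ ‖x‖ ^ 2
  · simp only [truncatedMat, if_pos hx]
    simp only [Matrix.zero_apply, ne_eq, OfNat.ofNat_ne_zero, not_false_eq_true, zero_pow,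
      Finset.sum_const_zero]
    positivity
  · have e : ∑ i, ∑ j, truncatedMat s x i j ^ 2 = s ^ 2 * ‖x‖ ^ 2 := by
      simp only [truncatedMat, if_neg hx, EuclideanSpace.real_norm_sq_eq, Fintype.sum_prod_type,
        Finset.mul_sum, Matrix.smul_apply, smul_eq_mul, mul_pow, toMat, of_apply]
    rw [e]
    nlinarith [sq_nonneg s]

theorem measure_le_add_of_eqOn_compl {X : Type*} [MeasurableSpace X] (ν : Measure X) {U : Set X}
    {P P' : X → Prop} (h : ∀ x ∉ U, P x → P' x) : ν {x | P x} ≤ ν {x | P' x} + ν U := by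
  refine (measure_mono fun x hx => ?_).trans (measure_union_le _ _)
  by_cases hU : x ∈ U
  · exact .inr hU
  · exact .inl (h x hU hx)

namespace DynamicAlgorithm

variable (alg : DynamicAlgorithm Ω n) (h : N ≤ n)

/-- Truncation changes each of the two events by at most the probability of a large norm, whence the
factor `2` in the error. -/
theorem isHardBlock_truncatedMat {s y ε : ℝ} {k : ℕ} (hs : 0 < s)
    (hy : 0 ≤ y) (hk : k < N) (hε : ε ≤ s * (y * √(N - k))) :
    alg.IsHardBlock h (stdGaussian (FrobeniusSpace N)) (truncatedMat s) k ε
      (ENNReal.ofReal (1 / 2 * Real.exp (-y - y ^ 2 / 2)))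
      (ENNReal.ofReal (2 * Real.exp (-((N : ℝ) ^ 2) / 2))) := by
  intro c I B ω E t J hE hI
  have hmain := alg.gaussian_block h c B ω (J := J) hE hI hs hy hk hε
  set ρ := ENNReal.ofReal (1 / 2 * Real.exp (-y - y ^ 2 / 2)) with hρ
  set γ := stdGaussian (FrobeniusSpace N) with hγ
  have hρ1 : ρ ≤ 1 := by
    rw [hρ, ENNReal.ofReal_le_one]
    have : Real.exp (-y - y ^ 2 / 2) ≤ 1 := by
      rw [Real.exp_le_one_iff]; nlinarith [sq_nonneg y]
    linarith
  set U := {x : FrobeniusSpace N | 4 * (N : ℝ) ^ 2 ≤ ‖x‖ ^ 2} with hU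
  have hUm : γ U ≤ ENNReal.ofReal (Real.exp (-((N : ℝ) ^ 2) / 2)) := by
    have := stdGaussian_norm_tail (Fin N × Fin N) (R := 4 * (N : ℝ) ^ 2)
    rw [← hγ, ← hU] at this
    rw [← ofReal_measureReal (measure_ne_top _ _)]
    refine ENNReal.ofReal_le_ofReal (this.trans (le_of_eq ?_))
    simp only [Fintype.card_prod, Fintype.card_fin]
    push_cast
    congr 1
    ring
  have hT : ∀ x ∉ U, truncatedMat s x = s • toMat x := fun x hx => if_neg hx
  have h1 : γ {x | (alg.run (t + 1) (blockStream h c I B (truncatedMat s x)) ω J).count ≤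
        (alg.run E (blockStream h c I B (truncatedMat s x)) ω J).count + k} ≤
      γ {x | (alg.run (t + 1) (blockStream h c I B (s • toMat x)) ω J).count ≤
        (alg.run E (blockStream h c I B (s • toMat x)) ω J).count + k} + γ U :=
    measure_le_add_of_eqOn_compl γ fun x hx hP => by rwa [hT x hx] at hP
  have h2 : γ {x | ¬ alg.Estimates (blockStream h c I B (s • toMat x)) ω J t
        (s • toMat x).trace ε} ≤
      γ {x | ¬ alg.Estimates (blockStream h c I B (truncatedMat s x)) ω J t
        (truncatedMat s x).trace ε} + γ U :=
    measure_le_add_of_eqOn_compl γ fun x hx hP => by rwa [hT x hx]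
  refine (mul_le_mul_right h1 ρ).trans ?_
  rw [mul_add]
  refine (add_le_add (hmain.trans h2) (mul_le_of_le_one_left' hρ1)).trans ?_
  rw [add_assoc, ← two_mul, ENNReal.ofReal_mul (by norm_num), ENNReal.ofReal_ofNat]
  gcongr

/-- The uniform distribution on two points. -/
noncomputable def _root_.coinMeasure : Measure Bool :=
  (2 : ENNReal)⁻¹ • (Measure.dirac true + Measure.dirac false)

theorem _root_.coinMeasure_apply (s : Set Bool) [DecidablePred (· ∈ s)] :
    coinMeasure s =
      (2 : ENNReal)⁻¹ * ((if true ∈ s then 1 else 0) + if false ∈ s then 1 else 0) := by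
  simp [coinMeasure, Set.indicator_apply, mul_add]

instance _root_.isProbabilityMeasure_coinMeasure : IsProbabilityMeasure coinMeasure := by
  classical
  refine ⟨?_⟩
  rw [coinMeasure_apply]
  simp only [Set.mem_univ, if_true]
  rw [one_add_one_eq_two]
  exact ENNReal.inv_mul_cancel (by norm_num) (by norm_num)

/-- A random sign. -/
def _root_.signMat (x : Bool) : Matrix (Fin 1) (Fin 1) ℝ := if x then 1 else -1

/-- Without queries the explored projection has trace zero, hence vanishes, and the run is the same
for both signs. One report cannot be within `ε < 1` of both `1` and `-1`. -/
theorem isHardBlock_signMat (h : 1 ≤ n) {ε : ℝ} (hε : ε < 1) :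
    alg.IsHardBlock h coinMeasure signMat 0 ε 2⁻¹ 0 := by
  classical
  intro c I B ω E t J hE hI
  set few := {x | (alg.run (t + 1) (blockStream h c I B (signMat x)) ω J).count ≤
        (alg.run E (blockStream h c I B (signMat x)) ω J).count + 0} with hfew
  set bad := {x | ¬ alg.Estimates (blockStream h c I B (signMat x)) ω J t (signMat x).trace ε}
    with hbad
  by_cases hne : few = ∅
  · rw [hne]; simp
  obtain ⟨x, hx⟩ := Set.nonempty_iff_ne_empty.2 hne
  have hex := alg.isExploration_run h c I B (t + 1) ω
  set r := fun G => alg.run (t + 1) (blockStream h c I B G) ω with hr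
  set w : Configuration n → Fin 1 → ℝ := alg.blockQuery h I (t + 1) ω with hw
  set p := exploredProj r w (signMat x) J with hp
  have hpp : IsOrthProj p := isOrthProj_exploredProj _ _
  have hp0 : p = 0 := by
    have h1 := alg.trace_exploredProj_add_count_le h c B hE hI ω (signMat x) J
    have h2 : ((alg.run (t + 1) (blockStream h c I B (signMat x)) ω J).count : ℝ) ≤
        (alg.run E (blockStream h c I B (signMat x)) ω J).count := by exact_mod_cast hx
    have h3 : p.trace ≤ 0 := by
      have h4 := h1.trans h2
      exact le_of_add_le_add_right (h4.trans_eq (zero_add _).symm)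
    have h4 : ‖ofMat p‖ ^ 2 = p.trace := by
      rw [norm_sq_eq_trace, toMat_ofMat, hpp.transpose_eq, hpp.mul_self]
    have h5 : ofMat p = 0 := by
      rw [← norm_eq_zero]
      nlinarith [norm_nonneg (ofMat p)]
    rw [← toMat_ofMat p, h5]
    rfl
  have hrun : ∀ G, alg.run (t + 1) (blockStream h c I B G) ω J =
      alg.run (t + 1) (blockStream h c I B (signMat x)) ω J := fun G =>
    (hex.congr (G := signMat x) (G' := G) (j := J) (by
      change G * p = signMat x * p
      rw [hp0, mul_zero, mul_zero])).1
  have hor : true ∈ bad ∨ false ∈ bad := by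
    by_contra! hcon
    have h1 := (not_not.1 hcon.1).2
    have h2 := (not_not.1 hcon.2).2
    rw [hrun] at h1 h2
    simp only [signMat, if_true, Bool.false_eq_true, if_false, trace_one, trace_neg,
      Fintype.card_fin, Nat.cast_one] at h1 h2
    rw [abs_le] at h1 h2
    linarith [h1.1, h2.2]
  have hb : (2 : ENNReal)⁻¹ ≤ coinMeasure bad := by
    rw [coinMeasure_apply]
    nth_rewrite 1 [← mul_one (2 : ENNReal)⁻¹]
    gcongr
    rcases hor with h | h
    · rw [if_pos h]; exact le_self_add
    · rw [if_pos h]; exact le_add_self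
  rw [add_zero]
  refine (mul_le_of_le_one_right' prob_le_one).trans hb

end DynamicAlgorithm

end Hard

/-! ### The triangle wave and its blocks. -/

section Schedule

/-- The block of matrices to which time step `i` belongs. -/
def blockIndex (s i : ℕ) : ℕ := (i + s) / (2 * s)

/-- A triangle wave of period `2 * s` with values in `[0, 1]` and maxima at the multiples of
`2 * s`. -/
noncomputable def triangleWave (s i : ℕ) : ℝ := |((i % (2 * s) : ℕ) : ℝ) - s| / s

/-- The first time step after the maximum in block `d - 1`. -/
def blockStart (s : ℕ) : ℕ → ℕ
  | 0 => 0
  | d + 1 => 2 * s * d + 1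

variable {s : ℕ}

theorem blockIndex_peak (hs : 0 < s) (d : ℕ) : blockIndex s (2 * s * d) = d := by
  rw [blockIndex, Nat.mul_add_div (by omega), Nat.div_eq_of_lt (by omega), add_zero]

theorem triangleWave_peak (hs : 0 < s) (d : ℕ) : triangleWave s (2 * s * d) = 1 := by
  rw [triangleWave, Nat.mul_mod_right]
  have : (0 : ℝ) < s := by exact_mod_cast hs
  rw [Nat.cast_zero, zero_sub, abs_neg, abs_of_pos this, div_self this.ne']

theorem triangleWave_nonneg (s i : ℕ) : 0 ≤ triangleWave s i := by
  unfold triangleWave; positivity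

theorem triangleWave_le_one (hs : 0 < s) (i : ℕ) : triangleWave s i ≤ 1 := by
  have h0 : (0 : ℝ) < s := by exact_mod_cast hs
  have h1 : i % (2 * s) < 2 * s := Nat.mod_lt _ (by omega)
  have h2 : ((i % (2 * s) : ℕ) : ℝ) < 2 * s := by exact_mod_cast h1
  have h3 : (0 : ℝ) ≤ ((i % (2 * s) : ℕ) : ℝ) := by positivity
  rw [triangleWave, div_le_one h0, abs_le]
  constructor <;> linarith

theorem abs_triangleWave_sub_le (hs : 0 < s) (i : ℕ) :
    |triangleWave s (i + 1) - triangleWave s i| ≤ 1 / s := by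
  have h0 : (0 : ℝ) < s := by exact_mod_cast hs
  have h1 : i % (2 * s) < 2 * s := Nat.mod_lt _ (by omega)
  rw [triangleWave, triangleWave, ← sub_div, abs_div, abs_of_pos h0]
  gcongr
  by_cases hq : i % (2 * s) + 1 < 2 * s
  · have : (i + 1) % (2 * s) = i % (2 * s) + 1 := by
      rw [Nat.add_mod, Nat.mod_eq_of_lt (a := 1) (by omega), Nat.mod_eq_of_lt hq]
    rw [this]
    refine (abs_abs_sub_abs_le_abs_sub _ _).trans ?_
    push_cast
    rw [show ((i % (2 * s) : ℕ) : ℝ) + 1 - s - (((i % (2 * s) : ℕ) : ℝ) - s) = 1 by ring, abs_one]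
  · have e : i % (2 * s) + 1 = 2 * s := by omega
    have : (i + 1) % (2 * s) = 0 := by
      rw [← Nat.mod_add_mod, e, Nat.mod_self]
    rw [this]
    have e' : ((i % (2 * s) : ℕ) : ℝ) = 2 * s - 1 := by
      rw [eq_sub_iff_add_eq]; exact_mod_cast e
    have hs1 : (1 : ℝ) ≤ s := by exact_mod_cast hs
    rw [e', Nat.cast_zero, zero_sub, abs_neg, abs_of_pos h0,
      show (2 * s - 1 - s : ℝ) = s - 1 by ring,
      abs_of_nonneg (show (0 : ℝ) ≤ (s : ℝ) - 1 by linarith)]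
    rw [show (s - (s - 1) : ℝ) = 1 by ring, abs_one]

/-- The wave vanishes where the block changes, so a step never mixes two different random matrices.
-/
theorem triangleWave_succ_eq_zero (hs : 0 < s) {i : ℕ}
    (h : blockIndex s (i + 1) ≠ blockIndex s i) : triangleWave s (i + 1) = 0 := by
  rw [blockIndex, blockIndex, show i + 1 + s = i + s + 1 by ring, Nat.succ_div] at h
  have hd : 2 * s ∣ i + s + 1 := by
    by_contra hd
    rw [if_neg hd] at h
    exact h rfl
  obtain ⟨k, hk⟩ := hd
  obtain ⟨l, rfl⟩ : ∃ l, k = l + 1 := Nat.exists_eq_succ_of_ne_zero (by rintro rfl; omega)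
  have e : i + 1 = 2 * s * l + s := by
    rw [mul_add] at hk
    omega
  rw [triangleWave, e, Nat.mul_add_mod, Nat.mod_eq_of_lt (by omega)]
  simp

/-- The window of a block opens just after the preceding peak, before any of its own matrices
arrives. Windows are then consecutive and disjoint. -/
theorem blockIndex_ne_of_lt_blockStart (hs : 0 < s) {d i : ℕ} (hi : i < blockStart s d) :
    blockIndex s i ≠ d := by
  cases d with
  | zero => simp [blockStart] at hi
  | succ d =>
    have h1 : blockIndex s i ≤ blockIndex s (2 * s * d) := by
      unfold blockIndex
      exact Nat.div_le_div_right (by simp only [blockStart] at hi; omega)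
    rw [blockIndex_peak hs] at h1
    omega

theorem blockStart_le_succ (s d : ℕ) : blockStart s d ≤ blockStart s (d + 1) := by
  cases d with
  | zero => simp [blockStart]
  | succ d => simp only [blockStart]; rw [mul_add]; omega

end Schedule

/-! ### The random stream: admissibility and resampling of one block. -/

section Streams

variable {N n : ℕ}

theorem schattenNorm_smul_corner_le (h : N ≤ n) {p : ℝ} (hp1 : 1 ≤ p) (hp2 : p ≤ 2)
    (hN : 0 < N) (a : ℝ) {G : Matrix (Fin N) (Fin N) ℝ}
    (hG : √(∑ i, ∑ j, G i j ^ 2) ≤ (N : ℝ) ^ (1 / 2 - 1 / p)) :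
    schattenNorm p (a • corner h G) ≤ |a| := by
  have hN0 : (0 : ℝ) < N := by exact_mod_cast hN
  rw [← corner_smul]
  refine (schattenNorm_corner_le h hp1 hp2 hN _).trans ?_
  have e : ∑ i, ∑ j, (a • G) i j ^ 2 = a ^ 2 * ∑ i, ∑ j, G i j ^ 2 := by
    simp only [Matrix.smul_apply, smul_eq_mul, mul_pow, Finset.mul_sum]
  rw [e, Real.sqrt_mul (sq_nonneg a), Real.sqrt_sq_eq_abs]
  calc _ ≤ (N : ℝ) ^ (1 / p - 1 / 2) * (|a| * (N : ℝ) ^ (1 / 2 - 1 / p)) := by gcongr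
    _ = |a| * ((N : ℝ) ^ (1 / p - 1 / 2) * (N : ℝ) ^ (1 / 2 - 1 / p)) := by ring
    _ = |a| := by
      rw [← Real.rpow_add hN0, show 1 / p - 1 / 2 + (1 / 2 - 1 / p) = 0 by ring, Real.rpow_zero,
        mul_one]

variable {X : Type*} {D : ℕ}

open Classical in
/-- The matrices of a finite family, continued by zero matrices. -/
noncomputable def blockMatrix (T : X → Matrix (Fin N) (Fin N) ℝ) (x : Fin D → X) (d : ℕ) :
    Matrix (Fin N) (Fin N) ℝ :=
  if hd : d < D then T (x ⟨d, hd⟩) else 0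

/-- The stream that moves back and forth between zero and the matrices `corner h (T (x d))`. -/
noncomputable def waveStream (h : N ≤ n) (s : ℕ) (T : X → Matrix (Fin N) (Fin N) ℝ)
    (x : Fin D → X) (i : ℕ) : Matrix (Fin n) (Fin n) ℝ :=
  triangleWave s i • corner h (blockMatrix T x (blockIndex s i))

/-- Isolates one block, with all others frozen, in the form required by `IsHardBlock`. -/
theorem waveStream_update (h : N ≤ n) (s : ℕ) (T : X → Matrix (Fin N) (Fin N) ℝ)
    (x : Fin D → X) (d : Fin D) (y : X) :
    waveStream h s T (Function.update x d y) =
      blockStream h (triangleWave s) {i | blockIndex s i = d} (waveStream h s T x) (T y) := by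
  funext i
  by_cases hi : blockIndex s i = d
  · simp only [waveStream, blockStream, Set.mem_ofPred_eq, if_pos hi]
    rw [blockMatrix, hi, dif_pos d.2]
    simp
  · simp only [waveStream, blockStream, Set.mem_ofPred_eq, if_neg hi]
    congr 2
    unfold blockMatrix
    split_ifs with hd
    · rw [Function.update_of_ne]
      rintro rfl
      exact hi rfl
    · rfl

theorem waveStream_peak (h : N ≤ n) {s : ℕ} (hs : 0 < s) (T : X → Matrix (Fin N) (Fin N) ℝ)
    (x : Fin D → X) (d : Fin D) : waveStream h s T x (2 * s * d) = corner h (T (x d)) := by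
  rw [waveStream, triangleWave_peak hs, blockIndex_peak hs, blockMatrix, dif_pos d.2, one_smul]

theorem isDynamicInput_waveStream (h : N ≤ n) {s : ℕ} (hs : 0 < s) {p α : ℝ} (hp1 : 1 ≤ p)
    (hp2 : p ≤ 2) (hN : 0 < N) (hα : 1 / s ≤ α) (m : ℕ) {T : X → Matrix (Fin N) (Fin N) ℝ}
    (hT : ∀ x, √(∑ i, ∑ j, T x i j ^ 2) ≤ (N : ℝ) ^ (1 / 2 - 1 / p)) (x : Fin D → X) :
    IsDynamicInput m p α (waveStream h s T x) := by
  have hB : ∀ d, √(∑ i, ∑ j, blockMatrix T x d i j ^ 2) ≤ (N : ℝ) ^ (1 / 2 - 1 / p) := by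
    intro d
    unfold blockMatrix
    split_ifs with hd
    · exact hT _
    · simp only [Matrix.zero_apply, ne_eq, OfNat.ofNat_ne_zero, not_false_eq_true, zero_pow,
        Finset.sum_const_zero, Real.sqrt_zero]
      positivity
  refine ⟨fun i _ => ?_, fun i _ => ?_⟩
  · refine (schattenNorm_smul_corner_le h hp1 hp2 hN _ (hB _)).trans ?_
    rw [abs_of_nonneg (triangleWave_nonneg s i)]
    exact triangleWave_le_one hs i
  · have hd := (abs_triangleWave_sub_le hs i).trans hα
    by_cases hb : blockIndex s (i + 1) = blockIndex s i
    · rw [waveStream, waveStream, hb, ← sub_smul]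
      exact (schattenNorm_smul_corner_le h hp1 hp2 hN _ (hB _)).trans hd
    · have h0 := triangleWave_succ_eq_zero hs hb
      rw [waveStream, waveStream, h0, zero_smul, zero_sub, ← neg_smul]
      rw [h0, zero_sub] at hd
      exact (schattenNorm_smul_corner_le h hp1 hp2 hN _ (hB _)).trans hd

theorem measurable_waveStream_apply [MeasurableSpace X] (h : N ≤ n) (s : ℕ)
    {T : X → Matrix (Fin N) (Fin N) ℝ} (hT : ∀ i j, Measurable fun x => T x i j)
    (k : ℕ) (i j : Fin n) : Measurable fun x : Fin D → X => waveStream h s T x k i j := by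
  unfold waveStream
  simp only [Matrix.smul_apply, smul_eq_mul]
  refine (measurable_corner_apply h (fun a b => ?_) i j).const_mul _
  unfold blockMatrix
  split_ifs with hd
  · exact (hT a b).comp (measurable_pi_apply _)
  · exact measurable_const

theorem measurable_update_prod [MeasurableSpace X] (d : Fin D) :
    Measurable fun q : (Fin D → X) × X => Function.update q.1 d q.2 := by
  refine measurable_pi_lambda _ fun i => ?_
  by_cases hi : i = d
  · subst hi; simpa using measurable_snd
  · simp only [Function.update_of_ne hi]
    exact (measurable_pi_apply i).comp measurable_fst

theorem map_update_pi [MeasurableSpace X] (ν : Measure X) [IsProbabilityMeasure ν] (d : Fin D) :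
    ((Measure.pi fun _ : Fin D => ν).prod ν).map (fun q => Function.update q.1 d q.2) =
      Measure.pi fun _ : Fin D => ν := by
  symm
  have hm := measurable_update_prod (X := X) d
  refine Measure.pi_eq fun S hS => ?_
  rw [Measure.map_apply hm (MeasurableSet.univ_pi hS)]
  have e : (fun q : (Fin D → X) × X => Function.update q.1 d q.2) ⁻¹' Set.univ.pi S =
      (Set.univ.pi (Function.update S d Set.univ)) ×ˢ S d := by
    ext q
    simp only [Set.mem_preimage, Set.mem_univ_pi, Set.mem_prod]
    constructor
    · intro hq
      refine ⟨fun i => ?_, by simpa using hq d⟩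
      by_cases hi : i = d
      · subst hi; simp
      · simpa [Function.update_of_ne hi] using hq i
    · rintro ⟨h1, h2⟩ i
      by_cases hi : i = d
      · subst hi; simpa using h2
      · simpa [Function.update_of_ne hi] using h1 i
  rw [e, Measure.prod_prod, Measure.pi_pi, ← Finset.mul_prod_erase _ _ (Finset.mem_univ d),
    ← Finset.mul_prod_erase Finset.univ (fun i => ν (S i)) (Finset.mem_univ d)]
  rw [Function.update_self, measure_univ, one_mul, mul_comm]
  congr 1
  refine Finset.prod_congr rfl fun i hi => ?_
  rw [Function.update_of_ne (Finset.ne_of_mem_erase hi)]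

/-- Redrawing one coordinate of a product measure preserves it, so the seed and the other blocks can
be fixed before drawing block `d`. -/
theorem measure_prod_eq_lintegral_update [MeasurableSpace X] (ν : Measure X)
    [IsProbabilityMeasure ν] {Ω : Type*} [MeasurableSpace Ω] (μ : Measure Ω)
    [IsProbabilityMeasure μ] (d : Fin D) {S : Set ((Fin D → X) × Ω)} (hS : MeasurableSet S) :
    ((Measure.pi fun _ : Fin D => ν).prod μ) S =
      ∫⁻ ω, ∫⁻ x, ν {y | (Function.update x d y, ω) ∈ S} ∂(Measure.pi fun _ : Fin D => ν) ∂μ := by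
  have hm := measurable_update_prod (X := X) d
  rw [Measure.prod_apply_symm hS]
  refine lintegral_congr fun ω => ?_
  have hSω : MeasurableSet ((fun x : Fin D → X => (x, ω)) ⁻¹' S) := measurable_prodMk_right hS
  rw [← map_update_pi ν d, Measure.map_apply hm hSω, Measure.prod_apply (hm hSω), map_update_pi]
  rfl

end Streams

/-! ### Adding up the queries over all blocks. -/

section LowerBound

variable {Ω : Type*} [MeasurableSpace Ω] {N n : ℕ}

namespace DynamicAlgorithm

variable (alg : DynamicAlgorithm Ω n) (h : N ≤ n)

theorem measure_not_estimates_le {μ : Measure Ω} [IsProbabilityMeasure μ] {m Q : ℕ}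
    {p α ε δ : ℝ} (hsolves : alg.Solves μ m p α ε δ) (huses : alg.UsesAtMost μ m p α Q)
    {A : ℕ → Matrix (Fin n) (Fin n) ℝ} (hA : IsDynamicInput m p α A) {i : ℕ} (hi : i < m) :
    μ {ω | ¬ alg.Estimates A ω (m + Q) i (A i).trace ε} ≤ ENNReal.ofReal δ := by
  have hmeas : MeasurableSet {ω | alg.Estimates A ω (m + Q) i (A i).trace ε} :=
    alg.measurableSet_estimates (A := fun _ => A) (fun _ _ _ => measurable_const) measurable_id
      (m + Q) i measurable_const ε
  have h1 := hsolves A hA i hi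
  have h2 : μ {ω | ∃ t, alg.Outputs m A ω i t ∧ |t - (A i).trace| ≤ ε} ≤
      μ {ω | alg.Estimates A ω (m + Q) i (A i).trace ε} := by
    -- The event in `Solves` need not be measurable; inclusion almost everywhere is enough, and
    -- complements are taken only of the measurable event.
    refine measure_mono_ae ?_
    filter_upwards [huses A hA] with ω hω
    rintro ⟨t, ht, hte⟩
    obtain ⟨h3, h4⟩ := ht.run_eq alg hω
    exact ⟨h3, by rwa [h4]⟩
  have h3 : 1 - δ ≤ μ.real {ω | alg.Estimates A ω (m + Q) i (A i).trace ε} :=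
    h1.trans (ENNReal.toReal_mono (measure_ne_top _ _) h2)
  have h4 := probReal_compl_eq_one_sub (μ := μ) hmeas
  rw [← ofReal_measureReal (measure_ne_top _ _)]
  refine ENNReal.ofReal_le_ofReal ?_
  change μ.real {ω | alg.Estimates A ω (m + Q) i (A i).trace ε}ᶜ ≤ δ
  linarith

/-- If random matrices of norm at most one are hard to handle with `k` queries, then every block
of the stream requires more than `k` queries with probability at least `η`. -/
theorem card_blocks_mul_le {μ : Measure Ω} [IsProbabilityMeasure μ] {m Q : ℕ}
    {p α ε δ : ℝ} (hsolves : alg.Solves μ m p α ε δ) (huses : alg.UsesAtMost μ m p α Q)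
    (hp1 : 1 ≤ p) (hp2 : p ≤ 2) (hN : 0 < N) {s : ℕ} (hs : 0 < s) (hα : 1 / s ≤ α)
    {X : Type*} [MeasurableSpace X] {ν : Measure X} [IsProbabilityMeasure ν]
    {T : X → Matrix (Fin N) (Fin N) ℝ} (hTm : ∀ i j, Measurable fun x => T x i j)
    (hT : ∀ x, √(∑ i, ∑ j, T x i j ^ 2) ≤ (N : ℝ) ^ (1 / 2 - 1 / p)) {k : ℕ} {ρ τ : ENNReal}
    (hhard : alg.IsHardBlock h ν T k ε ρ τ) {η : ℝ} (hη0 : 0 ≤ η) (hη1 : η ≤ 1) (hρ0 : ρ ≠ 0)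
    (hρt : ρ ≠ ⊤) (hρ : ENNReal.ofReal δ + τ ≤ ρ * ENNReal.ofReal (1 - η)) {D : ℕ}
    (hD : ∀ d < D, 2 * s * d < m) :
    η * (k + 1) * D ≤ Q := by
  set J := m + Q with hJ
  set π := Measure.pi fun _ : Fin D => ν with hπ
  set P := π.prod μ with hP
  set A : (Fin D → X) → ℕ → Matrix (Fin n) (Fin n) ℝ := fun x => waveStream h s T x with hA
  have hAin : ∀ x, IsDynamicInput m p α (A x) := fun x =>
    isDynamicInput_waveStream h hs hp1 hp2 hN hα m hT x
  have hAm : ∀ i r t, Measurable fun q : (Fin D → X) × Ω => A q.1 i r t := fun i r t =>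
    (measurable_waveStream_apply h s hTm i r t).comp measurable_fst
  set e : ℕ → (Fin D → X) × Ω → ℕ := fun d q =>
    (alg.run (blockStart s d) (A q.1) q.2 J).count with he
  have hem : ∀ d, Measurable (e d) := fun d =>
    Configuration.measurable_count.comp (alg.measurable_run _ hAm measurable_snd J)
  have heTotal : ∀ᵐ q ∂P, e D q ≤ Q := by
    have hset : MeasurableSet {q | e D q ≤ Q} := measurableSet_le (hem D) measurable_const
    rw [hP, Measure.ae_prod_iff_ae_ae hset]
    refine .of_forall fun x => ?_
    filter_upwards [huses (A x) (hAin x)] with ω hω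
    have hle : blockStart s D ≤ m := by
      cases D with
      | zero => exact Nat.zero_le _
      | succ D => exact hD D (Nat.lt_succ_self D)
    exact (alg.count_run_le_of_le m (A x) ω hle J).trans (hω J)
  set few : Fin D → Set ((Fin D → X) × Ω) := fun d => {q | e (d + 1) q ≤ e d q + k} with hfew
  have hfewm : ∀ d, MeasurableSet (few d) := fun d =>
    measurableSet_le (hem _) ((hem _).add_const k)
  have hfewP : ∀ d, P (few d) ≤ ENNReal.ofReal (1 - η) := by
    intro d
    set bad : Set ((Fin D → X) × Ω) :=
      {q | ¬ alg.Estimates (A q.1) q.2 J (2 * s * d) (A q.1 (2 * s * d)).trace ε} with hbad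
    have htr : Measurable fun q : (Fin D → X) × Ω => (A q.1 (2 * s * d)).trace := by
      simp only [Matrix.trace, Matrix.diag]
      exact Finset.measurable_sum _ fun i _ => hAm _ i i
    have hbadm : MeasurableSet bad :=
      (alg.measurableSet_estimates hAm measurable_snd J _ htr ε).compl
    have hbadP : P bad ≤ ENNReal.ofReal δ := by
      rw [hP, Measure.prod_apply hbadm]
      calc _ ≤ ∫⁻ _, ENNReal.ofReal δ ∂π := lintegral_mono fun x =>
            alg.measure_not_estimates_le hsolves huses (hAin x) (hD d d.2)
        _ = _ := by simp
    -- The hardness of one block, integrated over the seed and the other blocks.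
    have hkey : ρ * P (few d) ≤ P bad + τ := by
      rw [hP, measure_prod_eq_lintegral_update ν μ d (hfewm d),
        measure_prod_eq_lintegral_update ν μ d hbadm, ← lintegral_const_mul' _ _ hρt]
      calc _ ≤ ∫⁻ ω, ((∫⁻ x, ν {y | (Function.update x d y, ω) ∈ bad} ∂π) + τ) ∂μ := by
            refine lintegral_mono fun ω => ?_
            simp only
            rw [← lintegral_const_mul' _ _ hρt]
            calc _ ≤ ∫⁻ x, (ν {y | (Function.update x d y, ω) ∈ bad} + τ) ∂π := by
                  refine lintegral_mono fun x => ?_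
                  have := hhard (triangleWave s) {i | blockIndex s i = d} (waveStream h s T x) ω
                    (blockStart s d) (2 * s * d) J (blockStart_le_succ s d)
                    fun i hi => blockIndex_ne_of_lt_blockStart hs hi
                  convert this using 3
                  · ext y
                    simp only [hfew, he, hA, Set.mem_ofPred_eq, waveStream_update]
                    rfl
                  · congr 1
                    ext y
                    have ht : (T y).trace =
                        (waveStream h s T (Function.update x d y) (2 * s * d)).trace := by
                      rw [waveStream_peak h hs, trace_corner, Function.update_self]
                    simp only [hbad, hA, Set.mem_ofPred_eq, ht]
                    simp only [waveStream_update]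
              _ = _ := by rw [lintegral_add_right _ measurable_const]; simp
        _ = _ := by rw [lintegral_add_right _ measurable_const]; simp [hπ]
    refine (ENNReal.mul_le_mul_iff_right hρ0 hρt).1 ?_
    exact (hkey.trans (add_le_add hbadP le_rfl)).trans hρ
  have hmany : ∀ d, ENNReal.ofReal η ≤ P (few d)ᶜ := by
    intro d
    rw [prob_compl_eq_one_sub (hfewm d)]
    refine le_trans ?_ (tsub_le_tsub_left (hfewP d) 1)
    rw [← ENNReal.ofReal_one, ← ENNReal.ofReal_sub _ (by linarith)]
    exact ENNReal.ofReal_le_ofReal (by linarith)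
  -- Each window outside `few d` contains at least `k + 1` queries, and the increments of `e`
  -- telescope to at most `Q`.
  have hsum : ∑ d : Fin D, ((k + 1 : ℕ) : ENNReal) * P (few d)ᶜ ≤ Q := by
    calc ∑ d : Fin D, ((k + 1 : ℕ) : ENNReal) * P (few d)ᶜ
        = ∫⁻ q, ∑ d : Fin D, (few d)ᶜ.indicator (fun _ => ((k + 1 : ℕ) : ENNReal)) q ∂P := by
          rw [lintegral_finsetSum _ fun d _ => measurable_const.indicator (hfewm d).compl]
          refine Finset.sum_congr rfl fun d _ => ?_
          rw [lintegral_indicator_const (hfewm d).compl]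
      _ ≤ ∫⁻ _, (Q : ENNReal) ∂P := by
          refine lintegral_mono_ae ?_
          filter_upwards [heTotal] with q hq
          have hmono : Monotone fun d => e d q := monotone_nat_of_le_succ fun d =>
            alg.count_run_le_of_le _ _ _ (blockStart_le_succ s d) J
          have h1 : ∀ d : Fin D, (few d)ᶜ.indicator (fun _ => ((k + 1 : ℕ) : ENNReal)) q ≤
              ((e (d + 1) q - e d q : ℕ) : ENNReal) := by
            intro d
            by_cases hd : q ∈ (few d)ᶜ
            · rw [Set.indicator_of_mem hd]
              have : ¬ e (d + 1) q ≤ e d q + k := hd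
              exact_mod_cast (by omega : k + 1 ≤ e (d + 1) q - e d q)
            · rw [Set.indicator_of_notMem hd]; exact zero_le
          refine (Finset.sum_le_sum fun d _ => h1 d).trans ?_
          rw [← Nat.cast_sum, Fin.sum_univ_eq_sum_range (fun d => e (d + 1) q - e d q) D,
            Finset.sum_range_tsub hmono]
          exact_mod_cast (Nat.sub_le _ _).trans hq
      _ = Q := by simp
  have hfin : ∑ d : Fin D, ((k + 1 : ℕ) : ENNReal) * ENNReal.ofReal η ≤ Q :=
    (Finset.sum_le_sum fun d _ => mul_le_mul_right (hmany d) _).trans hsum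
  rw [Finset.sum_const, Finset.card_univ, Fintype.card_fin, nsmul_eq_mul] at hfin
  have hr := ENNReal.toReal_mono (by simp) hfin
  simp only [ENNReal.toReal_mul, ENNReal.toReal_natCast, ENNReal.toReal_ofReal hη0] at hr
  push_cast at hr
  linarith

theorem mul_length_le {μ : Measure Ω} [IsProbabilityMeasure μ] {m Q : ℕ}
    {p α ε δ : ℝ} (hsolves : alg.Solves μ m p α ε δ) (huses : alg.UsesAtMost μ m p α Q)
    (hp1 : 1 ≤ p) (hp2 : p ≤ 2) (hN : 0 < N) (hα0 : 0 < α) (hα1 : α ≤ 1)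
    {X : Type*} [MeasurableSpace X] {ν : Measure X} [IsProbabilityMeasure ν]
    {T : X → Matrix (Fin N) (Fin N) ℝ} (hTm : ∀ i j, Measurable fun x => T x i j)
    (hT : ∀ x, √(∑ i, ∑ j, T x i j ^ 2) ≤ (N : ℝ) ^ (1 / 2 - 1 / p)) {k : ℕ} {ρ τ : ENNReal}
    (hhard : alg.IsHardBlock h ν T k ε ρ τ) {η : ℝ} (hη0 : 0 ≤ η) (hη1 : η ≤ 1) (hρ0 : ρ ≠ 0)
    (hρt : ρ ≠ ⊤) (hρ : ENNReal.ofReal δ + τ ≤ ρ * ENNReal.ofReal (1 - η)) :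
    η * (k + 1) * (α * m / 4) ≤ Q := by
  set s := ⌈1 / α⌉₊ with hs
  have hinv : 1 ≤ 1 / α := by rw [le_div_iff₀ hα0]; linarith
  have hs0 : 0 < s := Nat.ceil_pos.2 (by linarith)
  have hs0' : (0 : ℝ) < s := by exact_mod_cast hs0
  have hs1 : 1 / α ≤ s := Nat.le_ceil _
  have hs2 : (s : ℝ) < 1 / α + 1 := Nat.ceil_lt_add_one (by linarith)
  have hsα : 1 / (s : ℝ) ≤ α := by
    rw [div_le_iff₀ hs0']
    rw [div_le_iff₀ hα0] at hs1
    linarith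
  have hs3 : α * s ≤ 2 := by
    have h1 : α * s ≤ α * (1 / α + 1) := mul_le_mul_of_nonneg_left hs2.le hα0.le
    rw [mul_add, mul_one_div_cancel hα0.ne'] at h1
    linarith
  -- The number of multiples of `2 * s` below `m`, that is, of peaks within the stream.
  set D := ⌈(m : ℝ) / (2 * s)⌉₊ with hD
  have hDlt : ∀ d < D, 2 * s * d < m := by
    intro d hd
    rw [hD, Nat.lt_ceil, lt_div_iff₀ (by positivity)] at hd
    have : ((2 * s * d : ℕ) : ℝ) < m := by push_cast; linarith
    exact_mod_cast this
  have hDle : α * m / 4 ≤ D := by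
    refine le_trans ?_ (Nat.le_ceil _)
    rw [le_div_iff₀ (by positivity)]
    nlinarith [mul_le_mul_of_nonneg_right hs3 (Nat.cast_nonneg (α := ℝ) m)]
  refine le_trans ?_ (alg.card_blocks_mul_le h hsolves huses hp1 hp2 hN hs0 hsα hTm hT hhard hη0
    hη1 hρ0 hρt hρ hDlt)
  gcongr

end DynamicAlgorithm

end LowerBound

/-! ### Choice of constants. -/

section Constants

/-- The exponent lost in the tail is at most `κ * (L + 1)` with `L = log (1/δ)`, while the right
side of the required inequality grows with slope one in `L`. As `κ ≤ 1`, it suffices to treat `δ =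
δ₀`, where `δ₀ < 1 / 2` leaves room for a positive `κ`. -/
theorem exists_tail_rate {δ₀ : ℝ} (h0 : 0 < δ₀) (h1 : δ₀ < 1 / 2) :
    ∃ κ : ℝ, 0 < κ ∧ κ ≤ 1 ∧ ∀ δ, 0 < δ → δ ≤ δ₀ →
      δ ≤ 1 / 2 * Real.exp (-(κ * √(Real.log (1 / δ))) - (κ * √(Real.log (1 / δ))) ^ 2 / 2) *
        (1 - (1 - 2 * δ₀) / 2) := by
  set β := 1 - (1 - 2 * δ₀) / 2 with hβ
  have hβ0 : 0 < β := by linarith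
  have hL0 : 0 < Real.log (1 / δ₀) :=
    Real.log_pos (by rw [lt_div_iff₀ h0]; linarith)
  have hr : 0 < Real.log (β / (2 * δ₀)) :=
    Real.log_pos (by rw [lt_div_iff₀ (by linarith)]; linarith)
  set κ := min 1 (Real.log (β / (2 * δ₀)) / (Real.log (1 / δ₀) + 1)) with hκ
  have hκ0 : 0 < κ := lt_min one_pos (by positivity)
  have hκ1 : κ ≤ 1 := min_le_left _ _
  refine ⟨κ, hκ0, hκ1, fun δ hδ hδ' => ?_⟩
  have hLL : Real.log (1 / δ₀) ≤ Real.log (1 / δ) :=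
    Real.log_le_log (by positivity) (one_div_le_one_div_of_le hδ hδ')
  set L := Real.log (1 / δ) with hL
  have hκL : κ * (Real.log (1 / δ₀) + 1) ≤ Real.log (β / (2 * δ₀)) := by
    rw [← le_div_iff₀ (by linarith)]; exact min_le_right _ _
  have hL' : Real.log δ = -L := by rw [hL, one_div, Real.log_inv, neg_neg]
  have hL0' : Real.log (1 / δ₀) = -Real.log δ₀ := by rw [one_div, Real.log_inv]
  rw [Real.log_div hβ0.ne' (by linarith), Real.log_mul (by norm_num) h0.ne'] at hκL
  have hsq : √L ^ 2 = L := Real.sq_sqrt (by linarith)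
  have hs0 := Real.sqrt_nonneg L
  have hexp : -(κ * √L) - (κ * √L) ^ 2 / 2 ≥ -(κ * (L + 1)) := by
    have h2 : √L ≤ (L + 1) / 2 := by nlinarith [sq_nonneg (√L - 1)]
    have h3 : (κ * √L) ^ 2 ≤ κ * L := by
      rw [mul_pow, hsq]
      exact mul_le_mul_of_nonneg_right (by nlinarith) (by linarith)
    nlinarith
  have hlog : Real.log δ ≤ -Real.log 2 - κ * (L + 1) + Real.log β := by
    rw [hL']
    nlinarith
  have hmain : δ ≤ 1 / 2 * Real.exp (-(κ * (L + 1))) * β := by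
    rw [← Real.exp_log hδ]
    refine (Real.exp_le_exp.2 hlog).trans (le_of_eq ?_)
    rw [Real.exp_add, Real.exp_log hβ0, sub_eq_add_neg, Real.exp_add, Real.exp_neg,
      Real.exp_log (by norm_num)]
    ring
  refine hmain.trans ?_
  gcongr

theorem log_lt_rpow {p L ε : ℝ} (hp : 1 ≤ p) (hL : 0 < L) (hε : 0 < ε)
    (h : ε < L ^ (1 / 2 - 1 / p)) : L < (√L / ε) ^ p := by
  have hp0 : 0 < p := by linarith
  have h1 : L ^ (1 / p) < √L / ε := by
    rw [lt_div_iff₀ hε]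
    calc L ^ (1 / p) * ε < L ^ (1 / p) * L ^ (1 / 2 - 1 / p) := by gcongr
      _ = √L := by rw [← Real.rpow_add hL, Real.sqrt_eq_rpow]; congr 1; ring
  calc L = (L ^ (1 / p)) ^ p := by
        rw [← Real.rpow_mul hL.le, one_div_mul_cancel hp0.ne', Real.rpow_one]
    _ < _ := Real.rpow_lt_rpow (by positivity) h1 hp0

/-- The Gaussian noise in the unexplored half of a rescaled matrix is large enough. -/
theorem le_noise_level {p ε y κ M : ℝ} {N k : ℕ} (hp1 : 1 ≤ p) (hp2 : p ≤ 2) (hε : 0 < ε)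
    (hM : 0 < M) (hκ0 : 0 < κ) (hκ1 : κ ≤ 1) (hy : y = κ * M) (hN : 0 < N)
    (hNK : (N : ℝ) ≤ κ ^ 2 / 8 * (M / ε) ^ p) (hk : (k : ℝ) ≤ N / 2) :
    ε ≤ (N : ℝ) ^ (-(1 / 2) - 1 / p) / 2 * (y * √(N - k)) := by
  have hp0 : 0 < p := by linarith
  have hN0 : (0 : ℝ) < N := by exact_mod_cast hN
  have hc0 : 0 < κ ^ 2 / 8 := by positivity
  have hc1 : κ ^ 2 / 8 ≤ 1 := by nlinarith
  have hMε : 0 < M / ε := by positivity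
  have h1 : (N : ℝ) ^ (1 / p) ≤ κ / √8 * (M / ε) := by
    calc (N : ℝ) ^ (1 / p) ≤ (κ ^ 2 / 8 * (M / ε) ^ p) ^ (1 / p) :=
          Real.rpow_le_rpow hN0.le hNK (by positivity)
      _ = (κ ^ 2 / 8) ^ (1 / p) * (M / ε) := by
          rw [Real.mul_rpow hc0.le (by positivity), ← Real.rpow_mul hMε.le,
            mul_one_div_cancel hp0.ne', Real.rpow_one]
      -- The base is at most one and `1 / p ≥ 1 / 2`; this makes the constant independent of `p`.
      _ ≤ (κ ^ 2 / 8) ^ (1 / 2 : ℝ) * (M / ε) := by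
          refine mul_le_mul_of_nonneg_right ?_ hMε.le
          exact Real.rpow_le_rpow_of_exponent_ge hc0 hc1
            (one_div_le_one_div_of_le hp0 hp2)
      _ = κ / √8 * (M / ε) := by
          rw [← Real.sqrt_eq_rpow, Real.sqrt_div (sq_nonneg κ), Real.sqrt_sq hκ0.le]
  have h2 : √((N : ℝ) / 2) ≤ √(N - k) := Real.sqrt_le_sqrt (by linarith)
  have h3 : ε * (N : ℝ) ^ (1 / p) ≤ κ / √8 * M := by
    calc ε * (N : ℝ) ^ (1 / p) ≤ ε * (κ / √8 * (M / ε)) := by gcongr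
      _ = κ / √8 * M := by field_simp
  have h8 : √8 = 2 * √2 := by
    rw [show (8 : ℝ) = 2 ^ 2 * 2 by norm_num, Real.sqrt_mul (by norm_num),
      Real.sqrt_sq (by norm_num)]
  have h4 : (N : ℝ) ^ (-(1 / 2) - 1 / p) = ((N : ℝ) ^ (1 / p))⁻¹ * (√N)⁻¹ := by
    rw [Real.sqrt_eq_rpow, ← Real.rpow_neg hN0.le, ← Real.rpow_neg hN0.le, ← Real.rpow_add hN0]
    congr 1
    ring
  have hq : 0 < (N : ℝ) ^ (1 / p) := by positivity
  have hs2 : (0 : ℝ) < √2 := by positivity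
  have hsN : (0 : ℝ) < √N := by positivity
  calc ε ≤ ((N : ℝ) ^ (1 / p))⁻¹ * (κ / √8 * M) := by
        rw [inv_mul_eq_div, le_div_iff₀ hq]; exact h3
    _ = (N : ℝ) ^ (-(1 / 2) - 1 / p) / 2 * (y * √((N : ℝ) / 2)) := by
        rw [h4, hy, h8, Real.sqrt_div hN0.le]
        field_simp
    _ ≤ _ := by
        have : 0 ≤ y := by rw [hy]; positivity
        gcongr

end Constants

/-! ### The lower bound. -/

theorem theorem5p3 :
    ∀ δ₀ : ℝ, δ₀ < 1 / 2 → ∃ c : ℝ, 0 < c ∧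
      ∀ p δ ε α : ℝ, 1 ≤ p → p ≤ 2 → 0 < δ → δ ≤ δ₀ → 0 < ε → ε < 1 →
        ε < Real.log (1 / δ) ^ (1 / 2 - 1 / p) → 0 < α → α ≤ 1 →
      ∀ m n : ℕ, (√(Real.log (1 / δ)) / ε) ^ p ≤ (n : ℝ) →
      ∀ (Ω : Type*) [MeasurableSpace Ω] (μ : Measure Ω) [IsProbabilityMeasure μ]
        (alg : DynamicAlgorithm Ω n) (Q : ℕ),
        alg.Solves μ m p α ε δ → alg.UsesAtMost μ m p α Q →
          c * (α * m * (√(Real.log (1 / δ)) / ε) ^ p) ≤ (Q : ℝ) := by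
  intro δ₀ hδ₀
  rcases le_or_gt δ₀ 0 with hneg | hpos
  · exact ⟨1, one_pos, fun p δ ε α _ _ h1 h2 => absurd (h1.trans_le h2) (not_lt.2 hneg)⟩
  obtain ⟨κ, hκ0, hκ1, hκ⟩ := exists_tail_rate hpos hδ₀
  set θ := 1 - 2 * δ₀ with hθ
  have hθ0 : 0 < θ := by linarith
  have hθ1 : θ < 1 := by linarith
  set c₂ := κ ^ 2 / 8 with hc₂
  have hc0 : 0 < c₂ := by positivity
  have hc1 : c₂ ≤ 1 / 8 := by rw [hc₂]; nlinarith
  set l := Real.log (8 / θ) with hl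
  have hl0 : 0 < l := Real.log_pos (by rw [lt_div_iff₀ hθ0]; linarith)
  -- The threshold beyond which `N² / 2 ≥ K * (1 + l) ≥ log (1/δ) + l`, so that truncation costs at
  -- most `δ * θ / 4`.
  set K₀ := 8 / c₂ ^ 2 * (1 + l) with hK₀
  have hK₀pos : 0 < K₀ := by positivity
  refine ⟨min (θ * c₂ / 64) (θ / (4 * K₀)), by positivity, ?_⟩
  intro p δ ε α hp1 hp2 hδ hδle hε hε1 hεL hα0 hα1 m n hn Ω _ μ _ alg Q hsolves huses
  have hρδ := hκ δ hδ hδle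
  have hL : 0 < Real.log (1 / δ) := Real.log_pos (by rw [lt_div_iff₀ hδ]; linarith)
  have hKL := log_lt_rpow hp1 hL hε hεL
  have hδL : Real.exp (-Real.log (1 / δ)) = δ := by
    rw [one_div, Real.log_inv, neg_neg, Real.exp_log hδ]
  set L := Real.log (1 / δ) with hLdef
  set K := (√L / ε) ^ p with hK
  have hK0 : 0 < K := hL.trans hKL
  have hαm : 0 ≤ α * m := by positivity
  -- For bounded `K`, at least one query per block with probability `θ` is enough, and `δ ≤ δ₀ = (1
  -- - θ) / 2` matches the failure rate of guessing a sign.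
  rcases lt_or_ge K K₀ with hsmall | hlarge
  · have hn1 : 1 ≤ n := by
      have : (0 : ℝ) < n := hK0.trans_le hn
      exact_mod_cast this
    have hb := alg.mul_length_le hn1 hsolves huses hp1 hp2 one_pos hα0 hα1 (T := signMat)
      (ν := coinMeasure) (fun _ _ => measurable_from_top) (fun x => by
        cases x <;> simp [signMat]) (alg.isHardBlock_signMat hn1 hε1) hθ0.le hθ1.le
      (by simp) (by simp) (by
        rw [add_zero, ← ENNReal.ofReal_ofNat 2, ← ENNReal.ofReal_inv_of_pos (by norm_num),
          ← ENNReal.ofReal_mul (by norm_num)]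
        exact ENNReal.ofReal_le_ofReal (by linarith))
    refine le_trans ?_ hb
    calc min (θ * c₂ / 64) (θ / (4 * K₀)) * (α * m * K)
        ≤ θ / (4 * K₀) * (α * m * K₀) := by
          gcongr
          exact min_le_right _ _
      _ = θ * ((0 : ℕ) + 1) * (α * m / 4) := by
          push_cast
          field_simp
          ring
  · have hc2K : 1 + l ≤ c₂ ^ 2 * K / 8 := by
      rw [hK₀, div_mul_eq_mul_div, div_le_iff₀ (by positivity)] at hlarge
      linarith
    have hK1 : 1 ≤ K := by nlinarith
    have hcK : 1 ≤ c₂ * K := by nlinarith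
    set N := ⌊c₂ * K⌋₊ with hN
    have hNle : (N : ℝ) ≤ c₂ * K := Nat.floor_le (by positivity)
    have hNpos : 0 < N := Nat.floor_pos.2 hcK
    have hN1 : (1 : ℝ) ≤ N := by exact_mod_cast hNpos
    have hNge : c₂ * K / 2 ≤ N := by
      have := Nat.lt_floor_add_one (c₂ * K)
      linarith
    have hNn : N ≤ n := by
      have : (N : ℝ) ≤ n := by nlinarith
      exact_mod_cast this
    set k := N / 2 with hk
    have hkN : k < N := Nat.div_lt_self hNpos (by norm_num)
    have hkle : (k : ℝ) ≤ N / 2 := Nat.cast_div_le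
    have hkge : (N : ℝ) / 2 ≤ k + 1 := by
      have : N ≤ 2 * (k + 1) := by omega
      have : (N : ℝ) ≤ 2 * (k + 1) := by exact_mod_cast this
      linarith
    -- The largest scale at which a matrix of Frobenius norm `2 * N` still has Schatten norm at most
    -- one by `schattenNorm_corner_le`.
    set s := (N : ℝ) ^ (-(1 / 2) - 1 / p) / 2 with hs
    have hs0 : 0 < s := by positivity
    set y := κ * √L with hy
    have hy0 : 0 ≤ y := by positivity
    have hnoise : ε ≤ s * (y * √(N - k)) :=
      le_noise_level hp1 hp2 hε (Real.sqrt_pos.2 hL) hκ0 hκ1 hy hNpos hNle hkle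
    have hsN : s * (2 * N) = (N : ℝ) ^ (1 / 2 - 1 / p) := by
      have hN0 : (0 : ℝ) < N := by linarith
      calc s * (2 * N) = (N : ℝ) ^ (-(1 / 2) - 1 / p) * (N : ℝ) ^ (1 : ℝ) := by
            rw [hs, Real.rpow_one]; ring
        _ = _ := by rw [← Real.rpow_add hN0]; congr 1; ring
    set ρ := 1 / 2 * Real.exp (-y - y ^ 2 / 2) with hρ
    have hρ0 : 0 < ρ := by positivity
    have hτ : 2 * Real.exp (-((N : ℝ) ^ 2) / 2) ≤ ρ * (θ / 4) := by
      have h1 : -((N : ℝ) ^ 2) / 2 ≤ -L - l := by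
        have h2 : (c₂ * K / 2) ^ 2 ≤ (N : ℝ) ^ 2 := pow_le_pow_left₀ (by positivity) hNge 2
        have h3 := mul_le_mul_of_nonneg_right hc2K hK0.le
        have h4 := mul_le_mul_of_nonneg_left hK1 hl0.le
        linarith
      have h3 : Real.exp (-l) = θ / 8 := by
        rw [hl, Real.exp_neg, Real.exp_log (by positivity), inv_div]
      have h4 : Real.exp (-((N : ℝ) ^ 2) / 2) ≤ δ * (θ / 8) := by
        rw [← h3, ← hδL, ← Real.exp_add]
        exact Real.exp_le_exp.2 (by linarith)
      have h5 : δ ≤ ρ := hρδ.trans (mul_le_of_le_one_right hρ0.le (by linarith))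
      have h6 := mul_le_mul_of_nonneg_right h5 hθ0.le
      linarith
    -- The choice of `κ` leaves a slack of `ρ * θ / 2` above `δ`: one half absorbs the truncation
    -- error, the other is the probability `η = θ / 4` of many queries.
    have hb := alg.mul_length_le hNn hsolves huses hp1 hp2 hNpos hα0 hα1
      (measurable_truncatedMat_apply s) (fun x => (sqrt_sum_sq_truncatedMat_le hs0.le x).trans_eq
        hsN) (alg.isHardBlock_truncatedMat hNn hs0 hy0 hkN hnoise) (η := θ / 4)
      (by positivity) (by linarith) (ENNReal.ofReal_pos.2 hρ0).ne' ENNReal.ofReal_ne_top (by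
        rw [← ENNReal.ofReal_add hδ.le (by positivity), ← ENNReal.ofReal_mul hρ0.le]
        exact ENNReal.ofReal_le_ofReal (by linarith))
    refine le_trans ?_ hb
    calc min (θ * c₂ / 64) (θ / (4 * K₀)) * (α * m * K)
        ≤ θ * c₂ / 64 * (α * m * K) := by
          gcongr
          exact min_le_left _ _
      _ = θ / 4 * (c₂ * K / 2 / 2) * (α * m / 4) := by ring
      _ ≤ θ / 4 * (k + 1) * (α * m / 4) := by
          gcongr
          linarith
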